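/- Identify $\mathbb{R}^3$ with the imaginary quaternions, let $\mathrm{Hopf}(q)=\bar q\,\mathbf{i}\,q$ for $q\in\mathbb{H}$, and apply $\mathrm{Hopf}$ coordinatewise to $\mathbb{H}^n=\mathbb{C}^n\oplus\mathbb{C}^n\mathbf{j}=\mathbb{R}^{4n}$. Let $\mathrm{Arm}_3(n)$ be the set of edge lists $(e_1,\dots,e_n)\in(\mathbb{R}^3)^n$ with $\sum_i|e_i|=2$, let $\mathrm{Arm}_2(n)\subset\mathrm{Arm}_3(n)$ be the set of those with all edges in the plane $\mathbf{i}\oplus\mathbf{k}$, and let $\mathrm{Pol}_m(n)=\{e\in\mathrm{Arm}_m(n):\sum_i e_i=0\}$ for $m=2,3$. Let $\mu$ be the symmetric measure on each of these spaces, that is, $\mu(U)=\mathrm{Vol}(M)^{-1}\int_{M\cap\mathrm{Hopf}^{-1}(U)}d\mathrm{Vol}_M$, where the model space $M\subset\mathbb{H}^n$, with the Riemannian volume of the metric induced from $\mathbb{R}^{4n}$, is respectively * for $\mathrm{Arm}_3(n)$: the sphere $S^{4n-1}$ of radius $\sqrt2$ in $\mathbb{H}^n$; * for $\mathrm{Pol}_3(n)$: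 the Stiefel manifold $V_2(\mathbb{C}^n)=\{u+v\mathbf{j}: u,v\in\mathbb{C}^n \text{ Hermitian orthonormal}\}$; * for $\mathrm{Arm}_2(n)$: the disjoint union $S^{2n-1}\sqcup S^{2n-1}$ of the spheres of radius $\sqrt2$ in $(1\oplus\mathbf{j})^n$ and in $(\mathbf{i}\oplus\mathbf{k})^n$; * for $\mathrm{Pol}_2(n)$: the disjoint union $V_2(\mathbb{R}^n)\sqcup\mathbf{i}V_2(\mathbb{R}^n)$, where $V_2(\mathbb{R}^n)=\{u+v\mathbf{j}: u,v\in\mathbb{R}^n\text{ orthonormal}\}$. These are probability measures on $\mathrm{Arm}_m(n)$ for $n\ge1$ and on $\mathrm{Pol}_m(n)$ for $n\ge2$. With respect to them, for every $1\le i\le n$, the variance of the edgelength $|e_i|$ is $$V(|e_i|,\mathrm{Arm}_3(n))=\frac{2(n-1)}{n^2(n+\frac12)},\qquad V(|e_i|,\mathrm{Arm}_2(n))=\frac{4(n-1)}{n^2(n+1)}\qquad(n\ge1),$$ $$V(|e_i|,\mathrm{Pol}_3(n))=\frac{2(n-2)}{n^2(n+1)},\qquad V(|e_i|,\mathrm{Pol}_2(n))=\frac{4(n-2)}{n^2(n+2)}\qquad(n\ge2),$$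 and for all $1\le i,j\le n$ with $i\ne j$ (so $n\ge2$) the covariance of the edgelengths is $$\mathrm{Cov}(|e_i|,|e_j|,\mathrm{Arm}_3(n))=\frac{-2}{n^2(n+\frac12)},\qquad \mathrm{Cov}(|e_i|,|e_j|,\mathrm{Pol}_3(n))=\frac{n-2}{n-1}\cdot\frac{-2}{n^2(n+1)},$$ $$\mathrm{Cov}(|e_i|,|e_j|,\mathrm{Arm}_2(n))=\frac{-4}{n^2(n+1)},\qquad \mathrm{Cov}(|e_i|,|e_j|,\mathrm{Pol}_2(n))=\frac{n-2}{n-1}\cdot\frac{-4}{n^2(n+2)}.$$ -/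

import Mathlib

open MeasureTheory ProbabilityTheory
open scoped Quaternion

noncomputable section

namespace RandomPolygon

/-! ### Edge lists and polygon spaces -/

/-- Edge lists `(e₁, …, eₙ)` in `ℝ³`, i.e. `n`-edge polygonal arms up to translation. The
coordinates `0, 1, 2` of `ℝ³` are the `𝐢, 𝐣, 𝐤` components of imaginary quaternions. -/
abbrev EdgeList (n : ℕ) : Type := Fin n → EuclideanSpace ℝ (Fin 3)

/-- Open space polygons (arms) with `n` edges and total length `2`, up to translation. -/
def Arm₃ (n : ℕ) : Set (EdgeList n) := {e | ∑ i, ‖e i‖ = 2}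

/-- Closed space polygons with `n` edges and total length `2`, up to translation. -/
def Pol₃ (n : ℕ) : Set (EdgeList n) := {e | e ∈ Arm₃ n ∧ ∑ i, e i = 0}

/-- Open planar polygons: the arms all of whose edges lie in the fixed plane `𝐢 ⊕ 𝐤`. -/
def Arm₂ (n : ℕ) : Set (EdgeList n) := {e | e ∈ Arm₃ n ∧ ∀ i, e i 1 = 0}

/-- Closed planar polygons, in the same fixed plane. -/
def Pol₂ (n : ℕ) : Set (EdgeList n) := {e | e ∈ Arm₂ n ∧ ∑ i, e i = 0}

/-! ### Quaternionic `n`-space and the Hopf map -/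

/-- The quaternions carry their Borel `σ`-algebra. -/
instance : MeasurableSpace ℍ[ℝ] := borel ℍ[ℝ]

instance : BorelSpace ℍ[ℝ] := ⟨rfl⟩

/-- Quaternionic `n`-space `ℍⁿ = ℝ⁴ⁿ`, with its Euclidean (`ℓ²`) norm. -/
abbrev QSpace (n : ℕ) : Type := EuclideanSpace ℍ[ℝ] (Fin n)

/-- The imaginary unit `𝐢`. -/
def quatI : ℍ[ℝ] := ⟨0, 1, 0, 0⟩

/-- The quaternion `a + b𝐣`, for complex numbers `a` and `b`. -/
def quatOfComplex (a b : ℂ) : ℍ[ℝ] := ⟨a.re, a.im, b.re, b.im⟩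

/-- The Hopf map `q ↦ q̄ 𝐢 q`, whose values are imaginary quaternions, read as vectors of `ℝ³`. -/
def hopf (q : ℍ[ℝ]) : EuclideanSpace ℝ (Fin 3) :=
  !₂[(star q * quatI * q).imI, (star q * quatI * q).imJ, (star q * quatI * q).imK]

/-- The coordinatewise Hopf map from `ℍⁿ` to edge lists. -/
def hopfMap (n : ℕ) (q : QSpace n) : EdgeList n := fun l => hopf (q l)

/-! ### The model spaces -/

/-- The sphere `S⁴ⁿ⁻¹` of radius `√2` in `ℍⁿ`. -/
def sphereH (n : ℕ) : Set (QSpace n) := Metric.sphere 0 (Real.sqrt 2)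

/-- The Stiefel manifold `V₂(ℂⁿ)` of Hermitian orthonormal 2-frames `(u, v)`, as the set of all
`u + v𝐣` in `ℍⁿ`. -/
def stiefelC (n : ℕ) : Set (QSpace n) :=
  {q | ∃ u v : EuclideanSpace ℂ (Fin n),
    Orthonormal ℂ ![u, v] ∧ ∀ l, q l = quatOfComplex (u l) (v l)}

/-- The disjoint union `S²ⁿ⁻¹ ⊔ S²ⁿ⁻¹` of the spheres of radius `√2` in `(1 ⊕ 𝐣)ⁿ` and in
`(𝐢 ⊕ 𝐤)ⁿ`. -/
def sphereC (n : ℕ) : Set (QSpace n) :=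
  {q | q ∈ sphereH n ∧ ∀ l, (q l).imI = 0 ∧ (q l).imK = 0} ∪
    {q | q ∈ sphereH n ∧ ∀ l, (q l).re = 0 ∧ (q l).imJ = 0}

/-- The disjoint union `V₂(ℝⁿ) ⊔ 𝐢 V₂(ℝⁿ)`: all `u + v𝐣` and all `𝐢(u + v𝐣)` in `ℍⁿ`, for real
orthonormal 2-frames `(u, v)`. -/
def stiefelR (n : ℕ) : Set (QSpace n) :=
  {q | ∃ u v : EuclideanSpace ℝ (Fin n),
    Orthonormal ℝ ![u, v] ∧ ∀ l, q l = quatOfComplex (u l) (v l)} ∪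
  {q | ∃ u v : EuclideanSpace ℝ (Fin n),
    Orthonormal ℝ ![u, v] ∧ ∀ l, q l = quatI * quatOfComplex (u l) (v l)}

/-! ### The symmetric measures -/

/-- The normalized Riemannian volume of a compact `d`-dimensional submanifold `M` of `ℍⁿ = ℝ⁴ⁿ`
(with the metric of the ambient space). The Riemannian volume of a submanifold of a Euclidean
space is a constant multiple, depending only on `d`, of `d`-dimensional Hausdorff measure; the
constant cancels in the normalization. -/
def normalizedVolume {n : ℕ} (d : ℝ) (M : Set (QSpace n)) : Measure (QSpace n) :=
  (Measure.hausdorffMeasure d M)⁻¹ • (Measure.hausdorffMeasure d).restrict M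

/-- The measure `U ↦ (Vol M)⁻¹ ∫_{Hopf⁻¹(U)} dVol_M` on a space `A` of polygons. -/
def polygonMeasure {n : ℕ} (d : ℝ) (M : Set (QSpace n)) (A : Set (EdgeList n)) : Measure A :=
  ((normalizedVolume d M).map (hopfMap n)).comap Subtype.val

/-- The symmetric measure on `Arm₃ n`, from `S⁴ⁿ⁻¹`. -/
def symmArm₃ (n : ℕ) : Measure (Arm₃ n) := polygonMeasure (4 * n - 1) (sphereH n) (Arm₃ n)

/-- The symmetric measure on `Pol₃ n`, from `V₂(ℂⁿ)`, which has dimension `4n - 4`. -/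
def symmPol₃ (n : ℕ) : Measure (Pol₃ n) := polygonMeasure (4 * n - 4) (stiefelC n) (Pol₃ n)

/-- The symmetric measure on `Arm₂ n`, from `S²ⁿ⁻¹ ⊔ S²ⁿ⁻¹`. -/
def symmArm₂ (n : ℕ) : Measure (Arm₂ n) := polygonMeasure (2 * n - 1) (sphereC n) (Arm₂ n)

/-- The symmetric measure on `Pol₂ n`, from `V₂(ℝⁿ) ⊔ 𝐢 V₂(ℝⁿ)`, of dimension `2n - 3`. -/
def symmPol₂ (n : ℕ) : Measure (Pol₂ n) := polygonMeasure (2 * n - 3) (stiefelR n) (Pol₂ n)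

/-- The length `|eᵢ|` of the `i`-th edge, as a function on a space `A` of polygons. -/
def edgeLength {n : ℕ} {A : Set (EdgeList n)} (i : Fin n) (e : A) : ℝ := ‖e.1 i‖

end RandomPolygon

end

/-! Since `‖hopf q‖ = ‖q‖ ^ 2`, the edgelengths of the polygon of `u + v𝐣` are the row norms `N i =
|u i|² + |v i|²`, and no finer information about the polygon is needed. Each model space is an
isometric copy of the sphere or the Stiefel manifold of pairs `(u, v)` over `𝕜 = ℂ` (space
polygons), or two disjoint congruent copies over `𝕜 = ℝ` (planar polygons) on which the row norms
have the same law. Everything therefore happens on `pairSphere 𝕜 n` and `frames 𝕜 n` with normalized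
Hausdorff measure.

The `N i` are exchangeable with constant sum `2`. Hence each has mean `2 / n`, and every covariance
is minus the variance divided by `n - 1` (`covariance_of_sum_eq`). Only `E (N i)²` remains, and no
integration is needed for it: invariance under the isometries of `𝕜ⁿ` and `𝕜²` suffices. If the law
of two entries `a`, `b` is invariant under exchange, the 45° reflection and a phase on `b`, then
`E|a|⁴ = (1 + τ) E|a|²|b|²`, with `τ = 1` over `ℂ` and `τ = 2` over `ℝ`
(`integral_norm_pow_four_eq`). This applies to two entries of one column or of one row. Multiplying
the constraint `‖u‖ = 1`, respectively `‖u‖² + ‖v‖² = 2`, by `|u i|²` and integrating gives a linear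
equation for `E|u i|⁴`. Then `E (N i)² = 2 (2 + τ) m` with `m = E|u i|⁴ / (1 + τ)`.

The normalization is meaningful because both model spaces are compact regular level sets of Gram
entries, so their Hausdorff measures in the right dimension are positive and finite
(`hausdorffMeasure_regular_levelSet`). -/

namespace RandomPolygon
open Filter Topology Set Module

/-! ### Hausdorff measure of regular level sets -/

section LevelSet

variable {X Y : Type*} [NormedAddCommGroup X] [NormedSpace ℝ X] [FiniteDimensional ℝ X]
  [MeasurableSpace X] [BorelSpace X]
  [NormedAddCommGroup Y] [NormedSpace ℝ Y] [FiniteDimensional ℝ Y]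
  {F : X → Y} {F' : X →L[ℝ] Y} {p : X}

/-- A level set of a submersion has locally finite Hausdorff measure in its own dimension. -/
theorem exists_nhds_hausdorffMeasure_levelSet_lt_top (hF : HasStrictFDerivAt F F' p)
    (hF' : F'.range = ⊤) :
    ∃ U ∈ 𝓝 p, μH[(finrank ℝ F'.ker : ℝ)] (U ∩ F ⁻¹' {F p}) < ⊤ := by
  have : CompleteSpace X := FiniteDimensional.complete ℝ X
  have : CompleteSpace Y := FiniteDimensional.complete ℝ Y
  have : ProperSpace F'.ker := FiniteDimensional.proper ℝ _
  -- The implicit function parametrizes the level set by the kernel of the derivative. Being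
  -- strictly differentiable at `0`, it is Lipschitz near `0`.
  obtain ⟨K, s, hs, hK⟩ := (hF.to_implicitFunction hF').exists_lipschitzOnWith
  set e := hF.implicitToOpenPartialHomeomorph F F' hF' with he
  have hcont : Tendsto (fun x => (e x).2) (𝓝 p) (𝓝 0) := by
    have h := (e.continuousAt (hF.mem_implicitToOpenPartialHomeomorph_source hF')).snd
    have h2 : (e p).2 = 0 := by rw [he, hF.implicitToOpenPartialHomeomorph_self hF']
    simpa [ContinuousAt, h2] using h
  let t := s ∩ Metric.closedBall (0 : F'.ker) 1
  have ht : t ∈ 𝓝 (0 : F'.ker) := inter_mem hs (Metric.closedBall_mem_nhds _ one_pos)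
  refine ⟨{x | (e x).2 ∈ t ∧ hF.implicitFunction F F' hF' (F x) (e x).2 = x},
    inter_mem (hcont ht) (hF.eq_implicitFunction hF'), ?_⟩
  have hsub : {x | (e x).2 ∈ t ∧ hF.implicitFunction F F' hF' (F x) (e x).2 = x} ∩ F ⁻¹' {F p} ⊆
      hF.implicitFunction F F' hF' (F p) '' t := by
    rintro x ⟨⟨h1, h2⟩, h3⟩
    refine ⟨(e x).2, h1, ?_⟩
    rw [← (h3 : F x = F p)]
    exact h2
  refine (measure_mono hsub).trans_lt
    (((hK.mono inter_subset_left).hausdorffMeasure_image_le (Nat.cast_nonneg _)).trans_lt ?_)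
  refine ENNReal.mul_lt_top (ENNReal.rpow_lt_top_of_nonneg (Nat.cast_nonneg _) ENNReal.coe_ne_top) ?_
  exact (measure_mono inter_subset_right).trans_lt (isCompact_closedBall _ _).measure_lt_top

/-- A level set of a submersion has positive Hausdorff measure in its own dimension. -/
theorem hausdorffMeasure_levelSet_pos (hF : HasStrictFDerivAt F F' p) (hF' : F'.range = ⊤) :
    0 < μH[(finrank ℝ F'.ker : ℝ)] (F ⁻¹' {F p}) := by
  have : CompleteSpace X := FiniteDimensional.complete ℝ X
  have : CompleteSpace Y := FiniteDimensional.complete ℝ Y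
  obtain ⟨π, hπ⟩ := Submodule.ClosedComplemented.of_finiteDimensional F'.ker
  have hder := hF.to_implicitFunction hF'
  set φ := hF.implicitFunction F F' hF' (F p) with hφ
  -- the composition of the parametrization with a linear projection is a local homeomorphism
  have hcomp : HasStrictFDerivAt (fun z => π (φ z)) (ContinuousLinearMap.id ℝ F'.ker) 0 := by
    have h := π.hasStrictFDerivAt.comp (0 : F'.ker) hder
    have h2 : π.comp F'.ker.subtypeL = ContinuousLinearMap.id ℝ F'.ker := by
      ext z; simp [hπ]
    rwa [h2] at h
  have hmap : map (fun z => π (φ z)) (𝓝 0) = 𝓝 (π (φ 0)) :=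
    hcomp.map_nhds_eq_of_surj (by simp)
  have hev : ∀ᶠ z in 𝓝 (0 : F'.ker), F (φ z) = F p := by
    have h := hF.map_implicitFunction_eq hF'
    rw [nhds_prod_eq] at h
    exact (h.curry.self_of_nhds)
  have himg : π '' (F ⁻¹' {F p}) ∈ 𝓝 (π (φ 0)) := by
    rw [← hmap]
    refine mem_of_superset (image_mem_map hev) ?_
    rintro _ ⟨z, hz, rfl⟩
    exact ⟨φ z, hz, rfl⟩
  -- On the kernel, Hausdorff measure of its own dimension is positive on neighbourhoods. The
  -- Lipschitz map `π` cannot send a null set onto one.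
  have hpos : 0 < μH[(finrank ℝ F'.ker : ℝ)] (π '' (F ⁻¹' {F p})) :=
    Measure.measure_pos_of_mem_nhds _ himg
  by_contra h0
  have h0 : μH[(finrank ℝ F'.ker : ℝ)] (F ⁻¹' {F p}) = 0 := by simpa using h0
  have hle := π.lipschitz.hausdorffMeasure_image_le
    (Nat.cast_nonneg (finrank ℝ F'.ker)) (F ⁻¹' {F p})
  rw [h0, mul_zero] at hle
  exact absurd hpos (not_lt.2 hle)

/-- A nonempty compact regular level set has positive finite Hausdorff measure in its dimension. -/
theorem hausdorffMeasure_regular_levelSet {c : Y} {d : ℝ} (hne : (F ⁻¹' {c}).Nonempty)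
    (hcomp : IsCompact (F ⁻¹' {c})) (hF : ContDiff ℝ 1 F)
    (hsurj : ∀ x, F x = c → Function.Surjective (fderiv ℝ F x))
    (hd : d + finrank ℝ Y = finrank ℝ X) :
    μH[d] (F ⁻¹' {c}) ≠ 0 ∧ μH[d] (F ⁻¹' {c}) ≠ ⊤ := by
  have hstrict : ∀ x, HasStrictFDerivAt F (fderiv ℝ F x) x := fun x =>
    hF.contDiffAt.hasStrictFDerivAt one_ne_zero
  have hrange : ∀ x, F x = c → (fderiv ℝ F x).range = ⊤ := fun x hx =>
    LinearMap.range_eq_top.2 (hsurj x hx)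
  have hdim : ∀ x, F x = c → (finrank ℝ (fderiv ℝ F x).ker : ℝ) = d := by
    intro x hx
    have h := (fderiv ℝ F x).toLinearMap.finrank_range_add_finrank_ker
    rw [hrange x hx, finrank_top] at h
    have h : (finrank ℝ Y : ℝ) + finrank ℝ (fderiv ℝ F x).ker = finrank ℝ X := by
      exact_mod_cast h
    linarith
  constructor
  · obtain ⟨p, hp⟩ := hne
    have hp : F p = c := hp
    have h := hausdorffMeasure_levelSet_pos (hstrict p) (hrange p hp)
    rw [hdim p hp, hp] at h
    exact h.ne'
  · refine (hcomp.measure_lt_top_of_nhdsWithin fun p hp => ?_).ne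
    have hp : F p = c := hp
    obtain ⟨U, hU, h⟩ := exists_nhds_hausdorffMeasure_levelSet_lt_top (hstrict p) (hrange p hp)
    rw [hdim p hp, hp] at h
    exact ⟨U ∩ F ⁻¹' {c}, inter_comm U _ ▸ inter_mem_nhdsWithin _ hU, h⟩

end LevelSet

/-! ### Spheres and Stiefel manifolds as level sets of the Gram matrix -/

section Frames

variable (𝕜 : Type*) [RCLike 𝕜] (n : ℕ)

/-- Pairs `(u, v)` of vectors of `𝕜ⁿ`, with the Euclidean norm. -/
abbrev FrameSpace : Type _ := EuclideanSpace (EuclideanSpace 𝕜 (Fin n)) (Fin 2)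

/-- The orthonormal `2`-frames of `𝕜ⁿ`. -/
def frames : Set (FrameSpace 𝕜 n) := {x | Orthonormal 𝕜 ![x 0, x 1]}

/-- The pairs of total squared norm `2`. -/
def pairSphere : Set (FrameSpace 𝕜 n) := Metric.sphere 0 (Real.sqrt 2)

variable {𝕜 n}

theorem norm_sq_frameSpace (x : FrameSpace 𝕜 n) : ‖x‖ ^ 2 = ‖x 0‖ ^ 2 + ‖x 1‖ ^ 2 := by
  rw [PiLp.norm_sq_eq_of_L2, Fin.sum_univ_two]

theorem mem_frames_iff {x : FrameSpace 𝕜 n} :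
    x ∈ frames 𝕜 n ↔ ‖x 0‖ = 1 ∧ ‖x 1‖ = 1 ∧ inner 𝕜 (x 0) (x 1) = 0 := by
  simp only [frames, mem_ofPred_eq, orthonormal_vecCons_iff]
  simp [Orthonormal]
  tauto

theorem mem_pairSphere_iff {x : FrameSpace 𝕜 n} :
    x ∈ pairSphere 𝕜 n ↔ ‖x 0‖ ^ 2 + ‖x 1‖ ^ 2 = 2 := by
  rw [pairSphere, mem_sphere_zero_iff_norm, ← norm_sq_frameSpace,
    ← sq_eq_sq₀ (norm_nonneg _) (Real.sqrt_nonneg _), Real.sq_sqrt (by norm_num)]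

theorem frames_subset_pairSphere : frames 𝕜 n ⊆ pairSphere 𝕜 n := fun x hx => by
  obtain ⟨h0, h1, -⟩ := mem_frames_iff.1 hx
  rw [mem_pairSphere_iff, h0, h1]; norm_num

/-- The entries of the Gram matrix of a pair of vectors. -/
def gram (x : FrameSpace 𝕜 n) : ℝ × ℝ × 𝕜 :=
  (RCLike.re (inner 𝕜 (x 0) (x 0)), RCLike.re (inner 𝕜 (x 1) (x 1)), inner 𝕜 (x 0) (x 1))

theorem contDiff_gram : ContDiff ℝ 1 (gram : FrameSpace 𝕜 n → ℝ × ℝ × 𝕜) := by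
  have h : ∀ i : Fin 2, ContDiff ℝ 1 (fun x : FrameSpace 𝕜 n => x i) := fun i =>
    (PiLp.proj 2 (fun _ : Fin 2 => EuclideanSpace 𝕜 (Fin n)) i : _ →L[ℝ] _).contDiff
  exact (RCLike.reCLM.contDiff.comp ((h 0).inner 𝕜 (h 0))).prodMk
    ((RCLike.reCLM.contDiff.comp ((h 1).inner 𝕜 (h 1))).prodMk ((h 0).inner 𝕜 (h 1)))

theorem fderiv_gram_apply (x y : FrameSpace 𝕜 n) :
    fderiv ℝ gram x y = (2 * RCLike.re (inner 𝕜 (x 0) (y 0)), 2 * RCLike.re (inner 𝕜 (x 1) (y 1)),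
      inner 𝕜 (x 0) (y 1) + inner 𝕜 (y 0) (x 1)) := by
  have h : ∀ i : Fin 2, HasFDerivAt (fun x : FrameSpace 𝕜 n => x i)
      (PiLp.proj 2 (fun _ : Fin 2 => EuclideanSpace 𝕜 (Fin n)) i : _ →L[ℝ] _) x := fun i =>
    (PiLp.proj 2 (fun _ : Fin 2 => EuclideanSpace 𝕜 (Fin n)) i : _ →L[ℝ] _).hasFDerivAt
  have hre : ∀ i, HasFDerivAt (fun x : FrameSpace 𝕜 n => RCLike.re (inner 𝕜 (x i) (x i))) _ x :=
    fun i => RCLike.reCLM.hasFDerivAt.comp x ((h i).inner 𝕜 (h i))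
  have hg : HasFDerivAt gram _ x := (hre 0).prodMk ((hre 1).prodMk ((h 0).inner 𝕜 (h 1)))
  rw [hg.fderiv]
  have hs : ∀ a b : EuclideanSpace 𝕜 (Fin n), RCLike.re (inner 𝕜 a b) + RCLike.re (inner 𝕜 b a) =
      2 * RCLike.re (inner 𝕜 a b) := fun a b => by
    rw [inner_re_symm (𝕜 := 𝕜) b a]; ring
  simp [hs, fderivInnerCLM_apply]

theorem frames_eq_preimage : frames 𝕜 n = gram ⁻¹' {((1 : ℝ), (1 : ℝ), (0 : 𝕜))} := by
  ext x
  rw [mem_frames_iff]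
  simp only [gram, mem_preimage, mem_singleton_iff, Prod.mk.injEq, inner_self_eq_norm_sq]
  rw [pow_eq_one_iff_of_nonneg (norm_nonneg _) two_ne_zero,
    pow_eq_one_iff_of_nonneg (norm_nonneg _) two_ne_zero]

theorem pairSphere_eq_preimage :
    pairSphere 𝕜 n = (fun x => (gram x).1 + (gram x).2.1) ⁻¹' {(2 : ℝ)} := by
  ext x
  rw [mem_pairSphere_iff]
  simp [gram]

theorem finrank_frameSpace : (finrank ℝ (FrameSpace 𝕜 n) : ℝ) = 2 * n * finrank ℝ 𝕜 := by
  have h1 : finrank ℝ (EuclideanSpace 𝕜 (Fin n)) = n * finrank ℝ 𝕜 := by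
    rw [(WithLp.linearEquiv 2 ℝ (Fin n → 𝕜)).finrank_eq, finrank_pi_fintype]; simp
  rw [(WithLp.linearEquiv 2 ℝ (Fin 2 → EuclideanSpace 𝕜 (Fin n))).finrank_eq, finrank_pi_fintype]
  simp [h1]; ring

theorem isCompact_pairSphere : IsCompact (pairSphere 𝕜 n) := isCompact_sphere _ _

theorem isClosed_frames : IsClosed (frames 𝕜 n) := by
  rw [frames_eq_preimage]
  exact isClosed_singleton.preimage contDiff_gram.continuous

theorem isCompact_frames : IsCompact (frames 𝕜 n) :=
  isCompact_pairSphere.of_isClosed_subset isClosed_frames frames_subset_pairSphere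

/-- The codimension `2 + finrank ℝ 𝕜` counts two real norm conditions and one `𝕜`-valued
orthogonality condition. -/
theorem hausdorffMeasure_frames (hn : 2 ≤ n) {d : ℝ}
    (hd : d + (2 + finrank ℝ 𝕜) = 2 * n * finrank ℝ 𝕜) :
    μH[d] (frames 𝕜 n) ≠ 0 ∧ μH[d] (frames 𝕜 n) ≠ ⊤ := by
  have hne : (frames 𝕜 n).Nonempty := by
    refine ⟨WithLp.toLp 2 ![EuclideanSpace.single ⟨0, by omega⟩ 1,
      EuclideanSpace.single ⟨1, by omega⟩ 1], ?_⟩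
    rw [mem_frames_iff]
    simp [EuclideanSpace.inner_single_left]
  have hcomp := isCompact_frames (𝕜 := 𝕜) (n := n)
  have hmem : ∀ x : FrameSpace 𝕜 n, gram x = ((1 : ℝ), (1 : ℝ), (0 : 𝕜)) → x ∈ frames 𝕜 n :=
    fun x hx => by rw [frames_eq_preimage]; exact hx
  rw [frames_eq_preimage] at hne hcomp ⊢
  refine hausdorffMeasure_regular_levelSet hne hcomp contDiff_gram ?_ ?_
  · rintro x hx ⟨r, s, z⟩
    obtain ⟨r, rfl⟩ : ∃ a, r = 2 * a := ⟨r / 2, by ring⟩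
    obtain ⟨s, rfl⟩ : ∃ a, s = 2 * a := ⟨s / 2, by ring⟩
    obtain ⟨h0, h1, h2⟩ := mem_frames_iff.1 (hmem x hx)
    -- At an orthonormal frame, scaling each vector moves only its own norm, and adding `z • x 0` to
    -- the second moves only the inner product. The derivative of `gram` in this direction is thus
    -- `(2r, 2s, z)`.
    refine ⟨WithLp.toLp 2 ![(r : 𝕜) • x 0, (s : 𝕜) • x 1 + z • x 0], ?_⟩
    have h3 : inner 𝕜 (x 1) (x 0) = 0 := by rw [← inner_conj_symm, h2, map_zero]
    rw [fderiv_gram_apply]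
    simp only [Matrix.cons_val_zero, Matrix.cons_val_one, inner_smul_right, inner_smul_left,
      inner_add_right, inner_self_eq_norm_sq_to_K, h0, h1, h2, h3]
    simp
  · rw [finrank_frameSpace, ← hd]
    simp [finrank_prod]; ring

theorem hausdorffMeasure_pairSphere (hn : 1 ≤ n) {d : ℝ} (hd : d + 1 = 2 * n * finrank ℝ 𝕜) :
    μH[d] (pairSphere 𝕜 n) ≠ 0 ∧ μH[d] (pairSphere 𝕜 n) ≠ ⊤ := by
  have hne : (pairSphere 𝕜 n).Nonempty := by
    refine ⟨WithLp.toLp 2 ![EuclideanSpace.single ⟨0, by omega⟩ 1,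
      EuclideanSpace.single ⟨0, by omega⟩ 1], ?_⟩
    rw [mem_pairSphere_iff]
    norm_num
  have hcomp := isCompact_pairSphere (𝕜 := 𝕜) (n := n)
  have hmem : ∀ x : FrameSpace 𝕜 n, (gram x).1 + (gram x).2.1 = 2 → x ∈ pairSphere 𝕜 n :=
    fun x hx => by rw [pairSphere_eq_preimage]; exact hx
  rw [pairSphere_eq_preimage] at hne hcomp ⊢
  refine hausdorffMeasure_regular_levelSet hne hcomp
    (contDiff_gram.fst.add contDiff_gram.snd.fst) ?_ ?_
  · intro x hx r
    have h := mem_pairSphere_iff.1 (hmem x hx)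
    have hg : HasFDerivAt gram (fderiv ℝ gram x) x :=
      (contDiff_gram.differentiable one_ne_zero x).hasFDerivAt
    -- The function is homogeneous quadratic with value `2` at `x`, so by Euler its derivative along
    -- `x` is `4`.
    refine ⟨((r / 4 : ℝ) : 𝕜) • x, ?_⟩
    have hf : HasFDerivAt (fun x : FrameSpace 𝕜 n => (gram x).1 + (gram x).2.1) _ x :=
      hg.fst.add hg.snd.fst
    rw [hf.fderiv]
    simp [fderiv_gram_apply, -map_div₀]
    linear_combination (r / 2) * h
  · rw [finrank_frameSpace, ← hd]; simp

end Frames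

/-! ### Reflections, phases and transpositions of coordinates -/

section Isometries

variable {𝕜 : Type*} [RCLike 𝕜] {ι : Type*} [Fintype ι] [DecidableEq ι]
  {W : Type*} [NormedAddCommGroup W] [InnerProductSpace 𝕜 W]

theorem inv_sqrt_two_sq : ((Real.sqrt 2)⁻¹ : ℝ) ^ 2 = 1 / 2 := by
  rw [inv_pow, Real.sq_sqrt (by norm_num)]; norm_num

theorem norm_inv_sqrt_two_smul_sq (w : W) :
    ‖(((Real.sqrt 2)⁻¹ : ℝ) : 𝕜) • w‖ ^ 2 = ‖w‖ ^ 2 / 2 := by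
  rw [norm_smul, mul_pow, RCLike.norm_ofReal, sq_abs, inv_sqrt_two_sq]; ring

/-- The `45°` reflection `(a, b) ↦ ((a + b) / √2, (a - b) / √2)` of the coordinates `α`, `β`. -/
noncomputable def mixCoords (𝕜 : Type*) [RCLike 𝕜] [InnerProductSpace 𝕜 W] [FiniteDimensional 𝕜 W]
    {α β : ι} (h : α ≠ β) : EuclideanSpace W ι ≃ₗᵢ[𝕜] EuclideanSpace W ι :=
  LinearIsometry.toLinearIsometryEquiv
    { toFun := fun x => WithLp.toLp 2 fun i =>
        if i = α then (((Real.sqrt 2)⁻¹ : ℝ) : 𝕜) • (x α + x β)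
        else if i = β then (((Real.sqrt 2)⁻¹ : ℝ) : 𝕜) • (x α - x β) else x i
      map_add' := fun x y => by
        ext i
        by_cases h1 : i = α
        · simp only [h1, if_true, PiLp.add_apply]; module
        · by_cases h2 : i = β
          · simp only [h2, if_true, PiLp.add_apply, h.symm, if_false]; module
          · simp [h1, h2]
      map_smul' := fun c x => by
        ext i
        by_cases h1 : i = α
        · simp only [h1, if_true, PiLp.smul_apply, RingHom.id_apply]; module
        · by_cases h2 : i = β
          · simp only [h2, if_true, PiLp.smul_apply, RingHom.id_apply, h.symm, if_false]; module
          · simp [h1, h2]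
      norm_map' := fun x => by
        rw [← sq_eq_sq₀ (norm_nonneg _) (norm_nonneg _), PiLp.norm_sq_eq_of_L2,
          PiLp.norm_sq_eq_of_L2, ← sub_eq_zero, ← Finset.sum_sub_distrib,
          Finset.sum_eq_add α β h]
        · have hp := parallelogram_law_with_norm 𝕜 (x α) (x β)
          simp only [LinearMap.coe_mk, AddHom.coe_mk, if_true, h.symm, if_false,
            norm_inv_sqrt_two_smul_sq]
          linear_combination hp / 2
        · rintro i - ⟨h1, h2⟩
          simp [h1, h2]
        · simp
        · simp }
    rfl

theorem mixCoords_left [FiniteDimensional 𝕜 W] {α β : ι} (h : α ≠ β) (x : EuclideanSpace W ι) :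
    mixCoords 𝕜 h x α = (((Real.sqrt 2)⁻¹ : ℝ) : 𝕜) • (x α + x β) := by
  simp [mixCoords]

theorem mixCoords_right [FiniteDimensional 𝕜 W] {α β : ι} (h : α ≠ β) (x : EuclideanSpace W ι) :
    mixCoords 𝕜 h x β = (((Real.sqrt 2)⁻¹ : ℝ) : 𝕜) • (x α - x β) := by
  simp [mixCoords, h.symm]

/-- Multiplication of the coordinate `β` by a scalar `ω` of norm one. -/
noncomputable def phaseCoord [FiniteDimensional 𝕜 W] {ω : 𝕜} (hω : ‖ω‖ = 1) (β : ι) : EuclideanSpace W ι ≃ₗᵢ[𝕜] EuclideanSpace W ι :=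
  LinearIsometry.toLinearIsometryEquiv
    { toFun := fun x => WithLp.toLp 2 fun i => if i = β then ω • x i else x i
      map_add' := fun x y => by
        ext i
        by_cases h : i = β <;> simp [h]
      map_smul' := fun c x => by
        ext i
        by_cases h : i = β <;> simp [h, smul_comm ω c]
      norm_map' := fun x => by
        rw [← sq_eq_sq₀ (norm_nonneg _) (norm_nonneg _), PiLp.norm_sq_eq_of_L2,
          PiLp.norm_sq_eq_of_L2]
        refine Finset.sum_congr rfl fun i _ => ?_
        by_cases h : i = β <;> simp [h, norm_smul, hω] }
    rfl

theorem phaseCoord_self [FiniteDimensional 𝕜 W] {ω : 𝕜} (hω : ‖ω‖ = 1) (β : ι) (x : EuclideanSpace W ι) :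
    phaseCoord hω β x β = ω • x β := by
  simp [phaseCoord]

theorem phaseCoord_of_ne [FiniteDimensional 𝕜 W] {ω : 𝕜} (hω : ‖ω‖ = 1) {α β : ι} (h : α ≠ β) (x : EuclideanSpace W ι) :
    phaseCoord hω β x α = x α := by
  simp [phaseCoord, h]

/-- The exchange of the coordinates `α` and `β`. -/
noncomputable def swapCoords (𝕜 : Type*) [RCLike 𝕜] [InnerProductSpace 𝕜 W] (α β : ι) :
    EuclideanSpace W ι ≃ₗᵢ[𝕜] EuclideanSpace W ι :=
  LinearIsometryEquiv.piLpCongrLeft 2 𝕜 W (Equiv.swap α β)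

theorem swapCoords_apply (α β i : ι) (x : EuclideanSpace W ι) :
    swapCoords 𝕜 α β x i = x (Equiv.swap α β i) := by
  simp [swapCoords, LinearIsometryEquiv.piLpCongrLeft_apply, Equiv.piCongrLeft'_apply]

end Isometries

/-! ### Fourth moments from invariance -/

section FourthMoment

variable {Ω : Type*} [MeasurableSpace Ω] {Q : Measure Ω}

theorem integral_comp_of_measurePreserving {T : Ω → Ω} (hT : MeasurePreserving T Q Q) {f : Ω → ℝ}
    (hf : Integrable f Q) : ∫ x, f (T x) ∂Q = ∫ x, f x ∂Q := by
  have h := hT.map_eq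
  conv_rhs => rw [← h]
  rw [integral_map hT.aemeasurable]
  rw [h]; exact hf.aestronglyMeasurable

variable {𝕜 : Type*} [RCLike 𝕜]

/-- If the law of a pair `(a, b)` of scalars is invariant under exchange, the `45°` reflection and
multiplication of `b` by `ω`, then `E|a|⁴ = (1 + τ) E|a|²|b|²`. -/
theorem integral_norm_pow_four_eq [TopologicalSpace Ω] (hQ : ∀ f : Ω → ℝ, Continuous f → Integrable f Q)
    {a b : Ω → 𝕜} (ha : Continuous a) (hb : Continuous b) {ω : 𝕜} {τ : ℝ}
    (hτ : ∀ z : 𝕜, RCLike.re z ^ 2 + RCLike.re (ω * z) ^ 2 = τ * ‖z‖ ^ 2)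
    {T J W : Ω → Ω} (hT : MeasurePreserving T Q Q) (hJ : MeasurePreserving J Q Q)
    (hW : MeasurePreserving W Q Q)
    (hTa : ∀ x, a (T x) = (((Real.sqrt 2)⁻¹ : ℝ) : 𝕜) • (a x + b x))
    (hTb : ∀ x, b (T x) = (((Real.sqrt 2)⁻¹ : ℝ) : 𝕜) • (a x - b x))
    (hJa : ∀ x, a (J x) = a x) (hJb : ∀ x, b (J x) = ω * b x)
    (hWa : ∀ x, a (W x) = b x) :
    ∫ x, ‖a x‖ ^ 4 ∂Q = (1 + τ) * ∫ x, ‖a x‖ ^ 2 * ‖b x‖ ^ 2 ∂Q := by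
  set R : Ω → ℝ := fun x => RCLike.re (inner 𝕜 (a x) (b x)) with hR
  have hRc : Continuous R := RCLike.continuous_re.comp (ha.inner hb)
  have iA : Integrable (fun x => ‖a x‖ ^ 4) Q := hQ _ (by fun_prop)
  have iB : Integrable (fun x => ‖b x‖ ^ 4) Q := hQ _ (by fun_prop)
  have iP : Integrable (fun x => ‖a x‖ ^ 2 * ‖b x‖ ^ 2) Q := hQ _ (by fun_prop)
  have iR : Integrable (fun x => R x ^ 2) Q := hQ _ (by fun_prop)
  have eW : ∫ x, ‖b x‖ ^ 4 ∂Q = ∫ x, ‖a x‖ ^ 4 ∂Q := by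
    simpa only [hWa] using integral_comp_of_measurePreserving hW iA
  -- `J` multiplies the inner product of `a` and `b` by `ω`. By `hτ` the squares of the real parts
  -- before and after add up to `τ |a|²|b|²`.
  have eJ : 2 * ∫ x, R x ^ 2 ∂Q = τ * ∫ x, ‖a x‖ ^ 2 * ‖b x‖ ^ 2 ∂Q := by
    have h1 := integral_comp_of_measurePreserving hJ iR
    have iJ : Integrable (fun x => R (J x) ^ 2) Q :=
      (hJ.integrable_comp iR.aestronglyMeasurable).2 iR
    rw [two_mul]
    nth_rewrite 2 [← h1]
    rw [← integral_add iR iJ, ← integral_const_mul]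
    refine integral_congr_ae (.of_forall fun x => ?_)
    have h2 := hτ (inner 𝕜 (a x) (b x))
    have h3 : ‖inner 𝕜 (a x) (b x)‖ = ‖a x‖ * ‖b x‖ := by
      rw [RCLike.inner_apply, norm_mul, RCLike.norm_conj, mul_comm]
    rw [h3, mul_pow] at h2
    simp only [hR, hJa, hJb, ← h2, ← smul_eq_mul ω (b x), inner_smul_right]
  -- Pointwise, `2 (|a ∘ T|⁴ + |b ∘ T|⁴) = (|a|² + |b|²)² + 4 R²`. Invariance under `T` turns this
  -- into a relation between moments of `a` and `b` alone.
  have eT : 2 * ∫ x, ‖a x‖ ^ 4 ∂Q + 2 * ∫ x, ‖b x‖ ^ 4 ∂Q =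
      ∫ x, ‖a x‖ ^ 4 ∂Q + ∫ x, ‖b x‖ ^ 4 ∂Q + 2 * ∫ x, ‖a x‖ ^ 2 * ‖b x‖ ^ 2 ∂Q +
        4 * ∫ x, R x ^ 2 ∂Q := by
    have iAT : Integrable (fun x => ‖a (T x)‖ ^ 4) Q :=
      (hT.integrable_comp iA.aestronglyMeasurable).2 iA
    have iBT : Integrable (fun x => ‖b (T x)‖ ^ 4) Q :=
      (hT.integrable_comp iB.aestronglyMeasurable).2 iB
    have hl : ∫ x, (2 * ‖a (T x)‖ ^ 4 + 2 * ‖b (T x)‖ ^ 4) ∂Q =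
        2 * ∫ x, ‖a x‖ ^ 4 ∂Q + 2 * ∫ x, ‖b x‖ ^ 4 ∂Q := by
      rw [integral_add (iAT.const_mul 2) (iBT.const_mul 2), integral_const_mul, integral_const_mul,
        integral_comp_of_measurePreserving hT iA, integral_comp_of_measurePreserving hT iB]
    have hr : ∫ x, (‖a x‖ ^ 4 + ‖b x‖ ^ 4 + 2 * (‖a x‖ ^ 2 * ‖b x‖ ^ 2) + 4 * R x ^ 2) ∂Q =
        ∫ x, ‖a x‖ ^ 4 ∂Q + ∫ x, ‖b x‖ ^ 4 ∂Q + 2 * ∫ x, ‖a x‖ ^ 2 * ‖b x‖ ^ 2 ∂Q +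
          4 * ∫ x, R x ^ 2 ∂Q := by
      rw [integral_add, integral_add, integral_add, integral_const_mul, integral_const_mul]
      all_goals exact hQ _ (by fun_prop)
    rw [← hl, ← hr]
    refine integral_congr_ae (.of_forall fun x => ?_)
    have h1 : ‖a (T x)‖ ^ 2 = (‖a x‖ ^ 2 + 2 * R x + ‖b x‖ ^ 2) / 2 := by
      rw [hTa, norm_inv_sqrt_two_smul_sq, norm_add_sq (𝕜 := 𝕜)]
    have h2 : ‖b (T x)‖ ^ 2 = (‖a x‖ ^ 2 - 2 * R x + ‖b x‖ ^ 2) / 2 := by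
      rw [hTb, norm_inv_sqrt_two_smul_sq, norm_sub_sq (𝕜 := 𝕜)]
    have h3 : ‖a (T x)‖ ^ 4 = (‖a (T x)‖ ^ 2) ^ 2 := by ring
    have h4 : ‖b (T x)‖ ^ 4 = (‖b (T x)‖ ^ 2) ^ 2 := by ring
    simp only [h3, h4, h1, h2]
    ring
  rw [eW] at eT
  linear_combination eT / 2 + eJ

end FourthMoment

/-! ### Invariant measures on pairs of vectors -/

section Invariant

variable {𝕜 : Type*} [RCLike 𝕜] {n : ℕ}

/-- Two linear isometries of `𝕜ⁿ`, acting on the two vectors of a pair. -/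
noncomputable def columnMaps
    (U : Fin 2 → (EuclideanSpace 𝕜 (Fin n) ≃ₗᵢ[𝕜] EuclideanSpace 𝕜 (Fin n))) :
    FrameSpace 𝕜 n ≃ₗᵢ[𝕜] FrameSpace 𝕜 n :=
  LinearIsometryEquiv.piLpCongrRight 2 U

theorem columnMaps_apply (U : Fin 2 → (EuclideanSpace 𝕜 (Fin n) ≃ₗᵢ[𝕜] EuclideanSpace 𝕜 (Fin n)))
    (x : FrameSpace 𝕜 n) (a : Fin 2) : columnMaps U x a = U a (x a) := rfl

/-- Invariance of a measure on pairs of vectors under linear isometries of `𝕜ⁿ` and of `𝕜²`. -/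
structure FrameInvariant (Q : Measure (FrameSpace 𝕜 n)) : Prop where
  integrable : ∀ f : FrameSpace 𝕜 n → ℝ, Continuous f → Integrable f Q
  columns : ∀ U : EuclideanSpace 𝕜 (Fin n) ≃ₗᵢ[𝕜] EuclideanSpace 𝕜 (Fin n),
    MeasurePreserving (columnMaps fun _ => U) Q Q
  mix : MeasurePreserving (mixCoords 𝕜 (zero_ne_one : (0 : Fin 2) ≠ 1)) Q Q
  phase : ∀ {ω : 𝕜} (hω : ‖ω‖ = 1), MeasurePreserving (phaseCoord hω (1 : Fin 2)) Q Q
  swap : MeasurePreserving (swapCoords 𝕜 (0 : Fin 2) 1) Q Q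

/-- The restriction of Hausdorff measure to a set, normalized to total mass one. -/
noncomputable def normalizedOn {X : Type*} [EMetricSpace X] [MeasurableSpace X] [BorelSpace X]
    (d : ℝ) (S : Set X) : Measure X :=
  (μH[d] S)⁻¹ • μH[d].restrict S

section NormalizedOn

variable {X : Type*} [EMetricSpace X] [MeasurableSpace X] [BorelSpace X] {d : ℝ} {S : Set X}

theorem isProbabilityMeasure_normalizedOn (h0 : μH[d] S ≠ 0) (h1 : μH[d] S ≠ ⊤) :
    IsProbabilityMeasure (normalizedOn d S) := by
  constructor
  rw [normalizedOn, Measure.smul_apply, Measure.restrict_apply_univ, smul_eq_mul,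
    ENNReal.inv_mul_cancel h0 h1]

/-- Mapping `S` into itself is enough: `S` lies in its preimage, which has the same finite measure,
so the two agree almost everywhere. -/
theorem measurePreserving_normalizedOn (hS : MeasurableSet S) (h1 : μH[d] S ≠ ⊤) (Ψ : X ≃ᵢ X)
    (hΨ : MapsTo Ψ S S) : MeasurePreserving Ψ (normalizedOn d S) (normalizedOn d S) := by
  have hmeas : MeasurableSet (Ψ ⁻¹' S) := Ψ.continuous.measurable hS
  have hpre : μH[d] (Ψ ⁻¹' S) = μH[d] S := Ψ.hausdorffMeasure_preimage d S
  have hae : S =ᵐ[μH[d]] Ψ ⁻¹' S :=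
    ae_eq_of_subset_of_measure_ge hΨ hpre.le hS.nullMeasurableSet (hpre ▸ h1)
  have h := (Ψ.measurePreserving_hausdorffMeasure d).restrict_preimage hS
  rw [← Measure.restrict_congr_set hae] at h
  exact h.smul_measure _

theorem integrable_normalizedOn (hS : IsCompact S) (h0 : μH[d] S ≠ 0) (h1 : μH[d] S ≠ ⊤)
    {f : X → ℝ} (hf : Continuous f) : Integrable f (normalizedOn d S) := by
  have : IsFiniteMeasure (μH[d].restrict S) := ⟨by simpa using h1.lt_top⟩
  obtain ⟨C, hC⟩ := hS.exists_bound_of_continuousOn hf.continuousOn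
  have hi : Integrable f (μH[d].restrict S) :=
    Integrable.of_bound hf.measurable.aestronglyMeasurable C
      ((ae_restrict_mem hS.measurableSet).mono hC)
  exact hi.smul_measure (ENNReal.inv_ne_top.2 h0)

theorem ae_mem_normalizedOn (hS : MeasurableSet S) : ∀ᵐ x ∂normalizedOn d S, x ∈ S :=
  Measure.ae_smul_measure (ae_restrict_mem hS) _

end NormalizedOn

theorem inner_smul_add_smul_sub {W : Type*} [NormedAddCommGroup W] [InnerProductSpace 𝕜 W]
    (a b : W) : inner 𝕜 ((((Real.sqrt 2)⁻¹ : ℝ) : 𝕜) • (a + b))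
      ((((Real.sqrt 2)⁻¹ : ℝ) : 𝕜) • (a - b)) =
      (1 / 2 : 𝕜) * (inner 𝕜 a a - inner 𝕜 a b + inner 𝕜 b a - inner 𝕜 b b) := by
  have h : (((Real.sqrt 2)⁻¹ : ℝ) : 𝕜) * (((Real.sqrt 2)⁻¹ : ℝ) : 𝕜) = 1 / 2 := by
    rw [← RCLike.ofReal_mul, ← pow_two, inv_sqrt_two_sq]; simp [map_ofNat]
  rw [inner_smul_left, inner_smul_right, RCLike.conj_ofReal, ← mul_assoc, h, inner_add_left,
    inner_sub_right, inner_sub_right]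
  ring

/-- Orthonormality survives an isometry of `𝕜ⁿ` applied to both vectors, and also a unitary change
of basis of their span. The latter covers the mixing, the phase and the exchange. -/
theorem frameInvariant_frames {d : ℝ} (h0 : μH[d] (frames 𝕜 n) ≠ 0)
    (h1 : μH[d] (frames 𝕜 n) ≠ ⊤) : FrameInvariant (normalizedOn d (frames 𝕜 n)) := by
  have key : ∀ Ψ : FrameSpace 𝕜 n ≃ₗᵢ[𝕜] FrameSpace 𝕜 n, (∀ x, ‖x 0‖ = 1 → ‖x 1‖ = 1 →
      inner 𝕜 (x 0) (x 1) = 0 →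
      ‖Ψ x 0‖ = 1 ∧ ‖Ψ x 1‖ = 1 ∧ inner 𝕜 (Ψ x 0) (Ψ x 1) = 0) →
      MeasurePreserving Ψ (normalizedOn d (frames 𝕜 n)) (normalizedOn d (frames 𝕜 n)) := by
    intro Ψ hΨ
    refine measurePreserving_normalizedOn isClosed_frames.measurableSet h1 Ψ.toIsometryEquiv ?_
    intro x hx
    obtain ⟨a, b, c⟩ := mem_frames_iff.1 hx
    exact mem_frames_iff.2 (hΨ x a b c)
  refine ⟨fun f hf => integrable_normalizedOn isCompact_frames h0 h1 hf, fun U => ?_, ?_,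
    fun {ω} hω => ?_, ?_⟩ <;> refine key _ fun x hx0 hx1 hx => ?_
  · simp [columnMaps_apply, hx0, hx1, hx]
  · rw [mixCoords_left, mixCoords_right, inner_smul_add_smul_sub,
      ← inner_conj_symm (x 1) (x 0), hx]
    have h2 : ∀ w : EuclideanSpace 𝕜 (Fin n), ‖w‖ ^ 2 = 1 → ‖w‖ = 1 := fun w hw =>
      (pow_eq_one_iff_of_nonneg (norm_nonneg _) two_ne_zero).1 hw
    refine ⟨h2 _ ?_, h2 _ ?_, ?_⟩
    · rw [norm_inv_sqrt_two_smul_sq, norm_add_sq (𝕜 := 𝕜), hx, hx0, hx1]; norm_num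
    · rw [norm_inv_sqrt_two_smul_sq, norm_sub_sq (𝕜 := 𝕜), hx, hx0, hx1]; norm_num
    · simp [inner_self_eq_norm_sq_to_K, hx0, hx1]
  · rw [phaseCoord_self, phaseCoord_of_ne hω zero_ne_one, inner_smul_right, hx, norm_smul, hω]
    simp [hx0, hx1]
  · simp only [swapCoords_apply, Equiv.swap_apply_left, Equiv.swap_apply_right]
    rw [← inner_conj_symm (x 1) (x 0), hx]
    simp [hx0, hx1]

theorem measurePreserving_pairSphere {d : ℝ} (h1 : μH[d] (pairSphere 𝕜 n) ≠ ⊤)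
    (Ψ : FrameSpace 𝕜 n ≃ₗᵢ[𝕜] FrameSpace 𝕜 n) :
    MeasurePreserving Ψ (normalizedOn d (pairSphere 𝕜 n)) (normalizedOn d (pairSphere 𝕜 n)) :=
  measurePreserving_normalizedOn isCompact_pairSphere.measurableSet h1 Ψ.toIsometryEquiv
    fun x hx => by simpa [pairSphere] using hx

theorem frameInvariant_pairSphere {d : ℝ} (h0 : μH[d] (pairSphere 𝕜 n) ≠ 0)
    (h1 : μH[d] (pairSphere 𝕜 n) ≠ ⊤) : FrameInvariant (normalizedOn d (pairSphere 𝕜 n)) :=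
  ⟨fun _ hf => integrable_normalizedOn isCompact_pairSphere h0 h1 hf,
    fun _ => measurePreserving_pairSphere h1 _, measurePreserving_pairSphere h1 _,
    fun _ => measurePreserving_pairSphere h1 _, measurePreserving_pairSphere h1 _⟩

namespace FrameInvariant

variable {Q : Measure (FrameSpace 𝕜 n)} (hQ : FrameInvariant Q) {ω : 𝕜} (hω : ‖ω‖ = 1) {τ : ℝ}
  (hτ : ∀ z : 𝕜, RCLike.re z ^ 2 + RCLike.re (ω * z) ^ 2 = τ * ‖z‖ ^ 2)
include hQ

theorem integral_row_swap (j k : Fin n) {f : FrameSpace 𝕜 n → ℝ} (hf : Continuous f) :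
    ∫ x, f (columnMaps (fun _ => swapCoords 𝕜 j k) x) ∂Q = ∫ x, f x ∂Q :=
  integral_comp_of_measurePreserving (hQ.columns _) (hQ.integrable f hf)

theorem integral_column_swap (i : Fin n) (m : ℕ) :
    ∫ x, ‖x 1 i‖ ^ m ∂Q = ∫ x, ‖x 0 i‖ ^ m ∂Q := by
  have h := integral_comp_of_measurePreserving hQ.swap
    (hQ.integrable (fun x => ‖x 0 i‖ ^ m) (by fun_prop))
  simpa only [swapCoords_apply, Equiv.swap_apply_left] using h

theorem integral_row_congr (i j : Fin n) (m : ℕ) :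
    ∫ x, ‖x 0 i‖ ^ m ∂Q = ∫ x, ‖x 0 j‖ ^ m ∂Q := by
  have h := hQ.integral_row_swap i j (f := fun x => ‖x 0 j‖ ^ m) (by fun_prop)
  simpa only [columnMaps_apply, swapCoords_apply, Equiv.swap_apply_right] using h

include hω hτ

theorem integral_pow_four_same_column {i k : Fin n} (h : i ≠ k) :
    ∫ x, ‖x 0 i‖ ^ 4 ∂Q = (1 + τ) * ∫ x, ‖x 0 i‖ ^ 2 * ‖x 0 k‖ ^ 2 ∂Q := by
  refine integral_norm_pow_four_eq hQ.integrable (a := fun x => x 0 i) (b := fun x => x 0 k)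
    (by fun_prop) (by fun_prop) hτ (hQ.columns (mixCoords 𝕜 h)) (hQ.columns (phaseCoord hω k))
    (hQ.columns (swapCoords 𝕜 i k)) (fun x => ?_) (fun x => ?_) (fun x => ?_) (fun x => ?_)
    (fun x => ?_)
  · rw [columnMaps_apply, mixCoords_left]
  · rw [columnMaps_apply, mixCoords_right]
  · rw [columnMaps_apply, phaseCoord_of_ne hω h]
  · rw [columnMaps_apply, phaseCoord_self, smul_eq_mul]
  · rw [columnMaps_apply, swapCoords_apply, Equiv.swap_apply_left]

theorem integral_pow_four_same_row (i : Fin n) :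
    ∫ x, ‖x 0 i‖ ^ 4 ∂Q = (1 + τ) * ∫ x, ‖x 0 i‖ ^ 2 * ‖x 1 i‖ ^ 2 ∂Q := by
  refine integral_norm_pow_four_eq hQ.integrable (a := fun x => x 0 i) (b := fun x => x 1 i)
    (by fun_prop) (by fun_prop) hτ hQ.mix (hQ.phase hω) hQ.swap (fun x => ?_) (fun x => ?_)
    (fun x => ?_) (fun x => ?_) (fun x => ?_)
  · rw [mixCoords_left]; rfl
  · rw [mixCoords_right]; rfl
  · rw [phaseCoord_of_ne hω zero_ne_one]
  · rw [phaseCoord_self]; rfl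
  · rw [swapCoords_apply, Equiv.swap_apply_left]

end FrameInvariant

end Invariant

/-! ### Exchangeable variables with constant sum -/

section Covariance

theorem natCast_sub_one_ne_zero {n : ℕ} {i j : Fin n} (h : i ≠ j) : (n : ℝ) - 1 ≠ 0 := by
  rw [sub_ne_zero, Nat.cast_ne_one]
  rintro rfl
  exact h (Subsingleton.elim _ _)

theorem sum_eq_add_of_forall_ne {n : ℕ} {f : Fin n → ℝ} (i : Fin n) {t : ℝ}
    (h : ∀ k, k ≠ i → f k = t) : ∑ k, f k = f i + (n - 1) * t := by
  rw [← Finset.add_sum_erase _ _ (Finset.mem_univ i),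
    Finset.sum_congr rfl (fun k hk => h k (Finset.ne_of_mem_erase hk)), Finset.sum_const,
    Finset.card_erase_of_mem (Finset.mem_univ i), Finset.card_fin, nsmul_eq_mul,
    Nat.cast_sub (Fin.pos i)]
  simp

variable {Ω : Type*} [MeasurableSpace Ω] {Q : Measure Ω} {n : ℕ}
  {N : Fin n → Ω → ℝ} {r s : ℝ}

theorem integral_eq_of_sum_eq [IsProbabilityMeasure Q] (hN : ∀ i, Integrable (N i) Q)
    (hsum : ∀ᵐ x ∂Q, ∑ k, N k x = r) (hmean : ∀ i j, ∫ x, N i x ∂Q = ∫ x, N j x ∂Q) (i : Fin n) :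
    ∫ x, N i x ∂Q = r / n := by
  have hn : (n : ℝ) ≠ 0 := by have := Fin.pos i; positivity
  have h : ∑ k, ∫ x, N k x ∂Q = r := by
    rw [← integral_finsetSum _ fun k _ => hN k, integral_congr_ae hsum]; simp
  rw [Finset.sum_congr rfl fun k _ => hmean k i] at h
  rw [eq_div_iff hn, ← h]
  simp; ring

/-- Multiplying the constant sum by `N i` and integrating ties the mixed moments to the second
moment. -/
theorem sum_integral_mul_of_sum_eq (hN : ∀ i, MemLp (N i) 2 Q)
    (hsum : ∀ᵐ x ∂Q, ∑ k, N k x = r) (i : Fin n) :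
    ∑ k, ∫ x, N i x * N k x ∂Q = r * ∫ x, N i x ∂Q := by
  have hi : ∀ k, Integrable (fun x => N i x * N k x) Q := fun k => (hN i).integrable_mul (hN k)
  rw [← integral_finsetSum _ fun k _ => hi k, ← integral_const_mul]
  refine integral_congr_ae (hsum.mono fun x hx => ?_)
  simp only [← Finset.mul_sum, hx]
  ring

/-- The covariances of exchangeable square integrable variables with constant sum. -/
theorem covariance_of_sum_eq [IsProbabilityMeasure Q] (hN : ∀ i, MemLp (N i) 2 Q) (hsum : ∀ᵐ x ∂Q, ∑ k, N k x = r)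
    (hmean : ∀ i j, ∫ x, N i x ∂Q = ∫ x, N j x ∂Q)
    (hprod : ∀ i j k, j ≠ i → k ≠ i → ∫ x, N i x * N j x ∂Q = ∫ x, N i x * N k x ∂Q)
    (hsq : ∀ i, ∫ x, N i x * N i x ∂Q = s) :
    (∀ i, covariance (N i) (N i) Q = s - r ^ 2 / n ^ 2) ∧
      ∀ i j, i ≠ j → covariance (N i) (N j) Q = -(s - r ^ 2 / n ^ 2) / (n - 1) := by
  have hE := integral_eq_of_sum_eq (fun i => (hN i).integrable one_le_two) hsum hmean
  have hcov : ∀ i j, covariance (N i) (N j) Q = ∫ x, N i x * N j x ∂Q - r ^ 2 / n ^ 2 := by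
    intro i j
    rw [covariance_eq_sub (hN i) (hN j), hE, hE]
    simp only [Pi.mul_apply]
    ring
  refine ⟨fun i => by rw [hcov, hsq], fun i j hij => ?_⟩
  have hn0 : (n : ℝ) ≠ 0 := by have := Fin.pos i; positivity
  have hn1 : (n : ℝ) - 1 ≠ 0 := natCast_sub_one_ne_zero hij
  have h := sum_integral_mul_of_sum_eq hN hsum i
  -- All mixed moments with `N i` being equal, `h` reads `s + (n - 1) E[N i N j] = r · (r / n)`.
  rw [sum_eq_add_of_forall_ne i fun k hk => hprod i k j hk hij.symm, hsq, hE] at h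
  rw [hcov, eq_div_iff hn1]
  field_simp at h ⊢
  linear_combination (n : ℝ) * h

end Covariance

/-! ### Second moments of the row norms -/

section EdgeLengths

variable {𝕜 : Type*} [RCLike 𝕜] {n : ℕ}

/-- The squared norm of the `i`-th row of a pair of vectors. -/
def rowNormSq (i : Fin n) (x : FrameSpace 𝕜 n) : ℝ := ‖x 0 i‖ ^ 2 + ‖x 1 i‖ ^ 2

theorem continuous_rowNormSq (i : Fin n) :
    Continuous (rowNormSq i : FrameSpace 𝕜 n → ℝ) := by
  unfold rowNormSq; fun_prop

theorem sum_rowNormSq (x : FrameSpace 𝕜 n) : ∑ i, rowNormSq i x = ‖x 0‖ ^ 2 + ‖x 1‖ ^ 2 := by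
  simp only [rowNormSq, Finset.sum_add_distrib, EuclideanSpace.norm_sq_eq]

variable {Q : Measure (FrameSpace 𝕜 n)} {ω : 𝕜} {τ : ℝ}

theorem FrameInvariant.memLp_two (hQ : FrameInvariant Q) {f : FrameSpace 𝕜 n → ℝ}
    (hf : Continuous f) : MemLp f 2 Q :=
  (memLp_two_iff_integrable_sq (hQ.integrable f hf).aestronglyMeasurable).2
    (hQ.integrable _ (hf.pow 2))

/-- Here `m` is the common value of `E|u i|²|v i|²`. The square of a row norm has two fourth powers,
each of mean `(1 + τ) m`, and twice the mixed term, in all `2 (2 + τ) m`. -/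
theorem FrameInvariant.covariance_rowNormSq [IsProbabilityMeasure Q] (hQ : FrameInvariant Q)
    (hω : ‖ω‖ = 1) (hτ0 : 0 ≤ τ)
    (hτ : ∀ z : 𝕜, RCLike.re z ^ 2 + RCLike.re (ω * z) ^ 2 = τ * ‖z‖ ^ 2)
    (hS : ∀ᵐ x ∂Q, x ∈ pairSphere 𝕜 n) {m : ℝ} (hm : ∀ i, ∫ x, ‖x 0 i‖ ^ 4 ∂Q = (1 + τ) * m) :
    (∀ i, covariance (rowNormSq i) (rowNormSq i) Q = 2 * (2 + τ) * m - 2 ^ 2 / n ^ 2) ∧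
      ∀ i j, i ≠ j → covariance (rowNormSq i) (rowNormSq j) Q =
        -(2 * (2 + τ) * m - 2 ^ 2 / n ^ 2) / (n - 1) := by
  have hrow : ∀ (i j k : Fin n) (x : FrameSpace 𝕜 n),
      rowNormSq i (columnMaps (fun _ => swapCoords 𝕜 j k) x) = rowNormSq (Equiv.swap j k i) x := by
    intro i j k x
    simp only [rowNormSq, columnMaps_apply, swapCoords_apply]
  refine covariance_of_sum_eq (fun i => hQ.memLp_two (continuous_rowNormSq i)) ?_ ?_ ?_ ?_
  · filter_upwards [hS] with x hx
    rw [sum_rowNormSq, mem_pairSphere_iff.1 hx]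
  · intro i j
    have h := hQ.integral_row_swap i j (continuous_rowNormSq (𝕜 := 𝕜) j)
    simpa only [hrow, Equiv.swap_apply_right] using h
  · intro i j k hj hk
    have h := hQ.integral_row_swap j k
      ((continuous_rowNormSq (𝕜 := 𝕜) i).mul (continuous_rowNormSq k))
    simpa only [Pi.mul_apply, hrow, Equiv.swap_apply_right,
      Equiv.swap_apply_of_ne_of_ne hj.symm hk.symm] using h
  · intro i
    have h1 := hQ.integral_pow_four_same_row hω hτ i
    have h2 := hQ.integral_column_swap i 4
    rw [hm] at h1 h2
    have h3 : ∫ x, ‖x 0 i‖ ^ 2 * ‖x 1 i‖ ^ 2 ∂Q = m :=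
      (mul_left_cancel₀ (by positivity) h1).symm
    have h4 : ∀ x : FrameSpace 𝕜 n, rowNormSq i x * rowNormSq i x =
        ‖x 0 i‖ ^ 4 + ‖x 1 i‖ ^ 4 + 2 * (‖x 0 i‖ ^ 2 * ‖x 1 i‖ ^ 2) := fun x => by
      unfold rowNormSq; ring
    simp only [h4]
    rw [integral_add, integral_add, integral_const_mul, hm, h2, h3]
    · ring
    all_goals exact hQ.integrable _ (by fun_prop)

/-- The fourth moment of an entry of a random orthonormal frame. -/
theorem integral_pow_four_frames {d : ℝ} (h0 : μH[d] (frames 𝕜 n) ≠ 0)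
    (h1 : μH[d] (frames 𝕜 n) ≠ ⊤) (hω : ‖ω‖ = 1) (hτ0 : 0 ≤ τ)
    (hτ : ∀ z : 𝕜, RCLike.re z ^ 2 + RCLike.re (ω * z) ^ 2 = τ * ‖z‖ ^ 2) (i : Fin n) :
    ∫ x, ‖x 0 i‖ ^ 4 ∂normalizedOn d (frames 𝕜 n) = (1 + τ) * (1 / (n * (n + τ))) := by
  set Q := normalizedOn d (frames 𝕜 n) with hQdef
  have : IsProbabilityMeasure Q := isProbabilityMeasure_normalizedOn h0 h1
  have hQ : FrameInvariant Q := frameInvariant_frames h0 h1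
  have hn : (0 : ℝ) < n := by have := Fin.pos i; positivity
  have hsum : ∀ᵐ x ∂Q, ∑ k, ‖x 0 k‖ ^ 2 = 1 := by
    filter_upwards [ae_mem_normalizedOn isClosed_frames.measurableSet] with x hx
    rw [← EuclideanSpace.norm_sq_eq, (mem_frames_iff.1 hx).1, one_pow]
  have hLp : ∀ k : Fin n, MemLp (fun x : FrameSpace 𝕜 n => ‖x 0 k‖ ^ 2) 2 Q := fun k =>
    hQ.memLp_two (by fun_prop)
  have hE := integral_eq_of_sum_eq (fun k => (hLp k).integrable one_le_two) hsum
    (fun i j => hQ.integral_row_congr i j 2) i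
  have h := sum_integral_mul_of_sum_eq hLp hsum i
  have h4 : ∫ x, ‖x 0 i‖ ^ 2 * ‖x 0 i‖ ^ 2 ∂Q = ∫ x, ‖x 0 i‖ ^ 4 ∂Q := by
    simp only [← pow_add]
  have hne : ∀ k, k ≠ i →
      ∫ x, ‖x 0 i‖ ^ 2 * ‖x 0 k‖ ^ 2 ∂Q = (∫ x, ‖x 0 i‖ ^ 4 ∂Q) / (1 + τ) := fun k hk => by
    rw [hQ.integral_pow_four_same_column hω hτ hk.symm]
    field_simp
  -- With `X = E|u i|⁴`, the relation is `X + (n - 1) X / (1 + τ) = 1 / n`.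
  rw [sum_eq_add_of_forall_ne i hne, hE, h4] at h
  field_simp at h ⊢
  linear_combination h

/-- The fourth moment of an entry of a random point of the sphere of radius `√2` in `𝕜ⁿ ⊕ 𝕜ⁿ`. -/
theorem integral_pow_four_pairSphere {d : ℝ} (h0 : μH[d] (pairSphere 𝕜 n) ≠ 0)
    (h1 : μH[d] (pairSphere 𝕜 n) ≠ ⊤) (hω : ‖ω‖ = 1) (hτ0 : 0 ≤ τ)
    (hτ : ∀ z : 𝕜, RCLike.re z ^ 2 + RCLike.re (ω * z) ^ 2 = τ * ‖z‖ ^ 2) (i : Fin n) :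
    ∫ x, ‖x 0 i‖ ^ 4 ∂normalizedOn d (pairSphere 𝕜 n) =
      (1 + τ) * (2 / (n * (2 * n + τ))) := by
  set Q := normalizedOn d (pairSphere 𝕜 n) with hQdef
  have : IsProbabilityMeasure Q := isProbabilityMeasure_normalizedOn h0 h1
  have hQ : FrameInvariant Q := frameInvariant_pairSphere h0 h1
  have hn : (0 : ℝ) < n := by have := Fin.pos i; positivity
  have hi : ∀ {f : FrameSpace 𝕜 n → ℝ}, Continuous f → Integrable f Q := hQ.integrable _
  -- On the sphere the second column may be permuted on its own, which reduces a mixed moment across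
  -- rows to one within row `i`. Such a permutation would destroy the orthogonality of a frame.
  have hrow : ∀ k : Fin n, ∫ x, ‖x 0 i‖ ^ 2 * ‖x 1 k‖ ^ 2 ∂Q =
      (∫ x, ‖x 0 i‖ ^ 4 ∂Q) / (1 + τ) := fun k => by
    have h := integral_comp_of_measurePreserving (measurePreserving_pairSphere h1
      (columnMaps ![LinearIsometryEquiv.refl 𝕜 _, swapCoords 𝕜 i k]))
      (hi (f := fun x => ‖x 0 i‖ ^ 2 * ‖x 1 k‖ ^ 2) (by fun_prop))
    have h2 : ∀ x : FrameSpace 𝕜 n,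
        columnMaps ![LinearIsometryEquiv.refl 𝕜 _, swapCoords 𝕜 i k] x 1 k = x 1 i := fun x => by
      change swapCoords 𝕜 i k (x 1) k = x 1 i
      rw [swapCoords_apply, Equiv.swap_apply_right]
    have h3 : ∀ x : FrameSpace 𝕜 n,
        columnMaps ![LinearIsometryEquiv.refl 𝕜 _, swapCoords 𝕜 i k] x 0 i = x 0 i := fun x => rfl
    simp only [h2, h3] at h
    rw [← h, hQ.integral_pow_four_same_row hω hτ i, hQdef]
    field_simp
  have hne : ∀ k, k ≠ i →
      ∫ x, ‖x 0 i‖ ^ 2 * ‖x 0 k‖ ^ 2 ∂Q = (∫ x, ‖x 0 i‖ ^ 4 ∂Q) / (1 + τ) := fun k hk => by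
    rw [hQ.integral_pow_four_same_column hω hτ hk.symm]
    field_simp
  -- The norm of a single column is not fixed here, so the mean comes from the row mean `2 / n`,
  -- shared equally by the two columns.
  have hE : ∫ x, ‖x 0 i‖ ^ 2 ∂Q = 1 / n := by
    have hsum : ∀ᵐ x ∂Q, ∑ k, rowNormSq k x = 2 := by
      filter_upwards [ae_mem_normalizedOn isCompact_pairSphere.measurableSet] with x hx
      rw [sum_rowNormSq, mem_pairSphere_iff.1 hx]
    have hrowmean : ∀ k, ∫ x, rowNormSq k x ∂Q = 2 * ∫ x, ‖x 0 k‖ ^ 2 ∂Q := fun k => by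
      unfold rowNormSq
      rw [integral_add (hi (by fun_prop)) (hi (by fun_prop)), hQ.integral_column_swap]
      ring
    have h := integral_eq_of_sum_eq (fun k => hi (continuous_rowNormSq k)) hsum
      (fun j k => by rw [hrowmean, hrowmean, hQ.integral_row_congr j k]) i
    rw [hrowmean] at h
    field_simp at h ⊢
    linear_combination h
  have h : ∑ k, ∫ x, ‖x 0 i‖ ^ 2 * ‖x 0 k‖ ^ 2 ∂Q + ∑ k, ∫ x, ‖x 0 i‖ ^ 2 * ‖x 1 k‖ ^ 2 ∂Q =
      2 * ∫ x, ‖x 0 i‖ ^ 2 ∂Q := by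
    rw [← integral_finsetSum _ fun k _ => hi (by fun_prop),
      ← integral_finsetSum _ fun k _ => hi (by fun_prop), ← integral_const_mul,
      ← integral_add (hi (by fun_prop)) (hi (by fun_prop))]
    refine integral_congr_ae ?_
    filter_upwards [ae_mem_normalizedOn isCompact_pairSphere.measurableSet] with x hx
    rw [← Finset.mul_sum, ← Finset.mul_sum, ← EuclideanSpace.norm_sq_eq,
      ← EuclideanSpace.norm_sq_eq, ← mul_add, mem_pairSphere_iff.1 hx, mul_comm]
  have h4 : ∫ x, ‖x 0 i‖ ^ 2 * ‖x 0 i‖ ^ 2 ∂Q = ∫ x, ‖x 0 i‖ ^ 4 ∂Q := by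
    simp only [← pow_add]
  -- With `X = E|u i|⁴`, the `2n - 1` other entries contribute equally: `X + (2n - 1) X / (1 + τ) =
  -- 2 / n`.
  rw [sum_eq_add_of_forall_ne i hne, h4, hE, Finset.sum_congr rfl fun k _ => hrow k,
    Finset.sum_const, Finset.card_fin, nsmul_eq_mul] at h
  field_simp at h ⊢
  linear_combination h

end EdgeLengths

/-! ### From polygon measures to laws of row norms -/

section Transfer

variable {n : ℕ}

theorem norm_sq_quatOfComplex (a b : ℂ) : ‖quatOfComplex a b‖ ^ 2 = ‖a‖ ^ 2 + ‖b‖ ^ 2 := by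
  rw [pow_two, ← Quaternion.normSq_eq_norm_mul_self, Quaternion.normSq_def', ← Complex.normSq_eq_norm_sq,
    ← Complex.normSq_eq_norm_sq, Complex.normSq_apply, Complex.normSq_apply]
  simp only [quatOfComplex]
  ring

theorem quatOfComplex_add (a b a' b' : ℂ) :
    quatOfComplex (a + a') (b + b') = quatOfComplex a b + quatOfComplex a' b' := rfl

theorem quatOfComplex_smul (c : ℝ) (a b : ℂ) :
    quatOfComplex (c • a) (c • b) = c • quatOfComplex a b := by
  ext
  · change (c • a).re = c * a.re; simp
  · change (c • a).im = c * a.im; simp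
  · change (c • b).re = c * b.re; simp
  · change (c • b).im = c * b.im; simp

theorem hopf_apply_zero (q : ℍ[ℝ]) :
    hopf q 0 = q.re ^ 2 + q.imI ^ 2 - q.imJ ^ 2 - q.imK ^ 2 := by
  have h : quatI.re = 0 ∧ quatI.imI = 1 ∧ quatI.imJ = 0 ∧ quatI.imK = 0 := ⟨rfl, rfl, rfl, rfl⟩
  change (star q * quatI * q).imI = _
  simp [h]
  ring

theorem hopf_apply_one (q : ℍ[ℝ]) :
    hopf q 1 = 2 * (q.imI * q.imJ - q.re * q.imK) := by
  have h : quatI.re = 0 ∧ quatI.imI = 1 ∧ quatI.imJ = 0 ∧ quatI.imK = 0 := ⟨rfl, rfl, rfl, rfl⟩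
  change (star q * quatI * q).imJ = _
  simp [h]
  ring

theorem hopf_apply_two (q : ℍ[ℝ]) :
    hopf q 2 = 2 * (q.re * q.imJ + q.imI * q.imK) := by
  have h : quatI.re = 0 ∧ quatI.imI = 1 ∧ quatI.imJ = 0 ∧ quatI.imK = 0 := ⟨rfl, rfl, rfl, rfl⟩
  change (star q * quatI * q).imK = _
  simp [h]
  ring

theorem norm_hopf (q : ℍ[ℝ]) : ‖hopf q‖ = ‖q‖ ^ 2 := by
  rw [← sq_eq_sq₀ (norm_nonneg _) (by positivity), EuclideanSpace.norm_sq_eq, pow_two ‖q‖,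
    ← Quaternion.normSq_eq_norm_mul_self, Quaternion.normSq_def', Fin.sum_univ_three]
  simp only [hopf_apply_zero, hopf_apply_one, hopf_apply_two, Real.norm_eq_abs, sq_abs]
  ring

theorem continuous_hopf : Continuous hopf := by
  have h : Continuous fun q : ℍ[ℝ] => star q * quatI * q := by fun_prop
  refine (PiLp.continuous_toLp 2 _).comp (continuous_pi fun i => ?_)
  fin_cases i
  · exact Quaternion.continuous_imI.comp h
  · exact Quaternion.continuous_imJ.comp h
  · exact Quaternion.continuous_imK.comp h

theorem continuous_hopfMap : Continuous (hopfMap n) :=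
  continuous_pi fun l => continuous_hopf.comp (PiLp.continuous_apply 2 _ l)

theorem isClosed_arm₃ : IsClosed (Arm₃ n) :=
  isClosed_eq (by fun_prop) continuous_const

theorem isClosed_pol₃ : IsClosed (Pol₃ n) :=
  isClosed_arm₃.inter (isClosed_eq (by fun_prop) continuous_const)

theorem isClosed_arm₂ : IsClosed (Arm₂ n) := by
  have h : IsClosed (⋂ i, {e : EdgeList n | e i 1 = 0}) :=
    isClosed_iInter fun i => isClosed_eq (by fun_prop) continuous_const
  convert isClosed_arm₃.inter h using 1
  ext e
  simp [Arm₂]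

theorem isClosed_pol₂ : IsClosed (Pol₂ n) :=
  isClosed_arm₂.inter (isClosed_eq (by fun_prop) continuous_const)

theorem measurable_edgeLength {A : Set (EdgeList n)} (i : Fin n) :
    Measurable (edgeLength i : A → ℝ) :=
  ((measurable_pi_apply i).comp measurable_subtype_coe).norm

/-- The joint law of the edge lengths under a symmetric measure. -/
theorem map_edgeLength_polygonMeasure {d : ℝ} {M : Set (QSpace n)} {A : Set (EdgeList n)}
    (hM : MeasurableSet M) (hA : MeasurableSet A) (hMA : MapsTo (hopfMap n) M A) :
    (polygonMeasure d M A).map (fun e i => edgeLength i e) =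
      (normalizedVolume d M).map (fun q i => ‖q i‖ ^ 2) := by
  have hlen : Measurable fun (e : EdgeList n) (i : Fin n) => ‖e i‖ := by fun_prop
  have hcomp : (fun (e : A) (i : Fin n) => edgeLength i e) =
      (fun (e : EdgeList n) (i : Fin n) => ‖e i‖) ∘ Subtype.val := rfl
  -- Pulling back to `A` and pushing forward again restricts to `A`. This changes nothing, since
  -- `hMA` concentrates the image measure on `A`.
  rw [hcomp, ← Measure.map_map hlen measurable_subtype_coe, polygonMeasure,
    map_comap_subtype_coe hA, Measure.restrict_eq_self_of_ae_mem,
    Measure.map_map hlen continuous_hopfMap.measurable]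
  · congr 1
    ext q i
    simp [hopfMap, norm_hopf]
  · refine (ae_map_iff (p := (· ∈ A)) continuous_hopfMap.aemeasurable hA).2 ?_
    exact Measure.ae_smul_measure ((ae_restrict_mem hM).mono hMA) _

variable {𝕜 : Type*} [RCLike 𝕜]

/-- The embedding `(u, v) ↦ w (u + v𝐣)` of pairs of vectors into quaternionic `n`-space. -/
noncomputable def frameEmbed (n : ℕ) (g : 𝕜 →ₗᵢ[ℝ] ℂ) {w : ℍ[ℝ]} (hw : ‖w‖ = 1) :
    FrameSpace 𝕜 n →ₗᵢ[ℝ] QSpace n where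
  toFun x := WithLp.toLp 2 fun l => w * quatOfComplex (g (x 0 l)) (g (x 1 l))
  map_add' x y := by
    ext l : 1
    simp only [PiLp.add_apply, map_add, quatOfComplex_add, mul_add]
  map_smul' c x := by
    ext l : 1
    simp only [PiLp.smul_apply, map_smul, RingHom.id_apply, quatOfComplex_smul, mul_smul_comm]
  norm_map' x := by
    rw [← sq_eq_sq₀ (norm_nonneg _) (norm_nonneg _), PiLp.norm_sq_eq_of_L2, norm_sq_frameSpace,
      EuclideanSpace.norm_sq_eq, EuclideanSpace.norm_sq_eq, ← Finset.sum_add_distrib]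
    refine Finset.sum_congr rfl fun l _ => ?_
    simp [hw, norm_sq_quatOfComplex]

theorem frameEmbed_apply (g : 𝕜 →ₗᵢ[ℝ] ℂ) {w : ℍ[ℝ]} (hw : ‖w‖ = 1) (x : FrameSpace 𝕜 n)
    (l : Fin n) : frameEmbed n g hw x l = w * quatOfComplex (g (x 0 l)) (g (x 1 l)) := rfl

theorem norm_sq_frameEmbed_apply (g : 𝕜 →ₗᵢ[ℝ] ℂ) {w : ℍ[ℝ]} (hw : ‖w‖ = 1)
    (x : FrameSpace 𝕜 n) (l : Fin n) : ‖frameEmbed n g hw x l‖ ^ 2 = rowNormSq l x := by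
  simp [frameEmbed_apply, hw, norm_sq_quatOfComplex, rowNormSq]

theorem restrict_hausdorffMeasure_image {X Y : Type*} [EMetricSpace X] [MeasurableSpace X]
    [BorelSpace X] [EMetricSpace Y] [MeasurableSpace Y] [BorelSpace Y] [CompleteSpace X]
    {f : X → Y} (hf : Isometry f) {d : ℝ} (hd : 0 ≤ d) (S : Set X) :
    μH[d].restrict (f '' S) = (μH[d].restrict S).map f := by
  have h := hf.isClosedEmbedding.measurableEmbedding.restrict_map μH[d] (f '' S)
  rw [hf.map_hausdorffMeasure (Or.inl hd), preimage_image_eq _ hf.injective,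
    Measure.restrict_restrict_of_subset (image_subset_range f S)] at h
  exact h

theorem map_normalizedVolume_image {d : ℝ} (hd : 0 ≤ d) (S : Set (FrameSpace 𝕜 n))
    (g : 𝕜 →ₗᵢ[ℝ] ℂ) {w : ℍ[ℝ]} (hw : ‖w‖ = 1) :
    (normalizedVolume d (frameEmbed n g hw '' S)).map (fun q i => ‖q i‖ ^ 2) =
      (normalizedOn d S).map (fun x i => rowNormSq i x) := by
  have hm : Measurable fun (q : QSpace n) (i : Fin n) => ‖q i‖ ^ 2 :=
    measurable_pi_lambda _ fun i => by fun_prop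
  rw [normalizedVolume, normalizedOn, (frameEmbed n g hw).isometry.hausdorffMeasure_image
    (Or.inl hd), restrict_hausdorffMeasure_image (frameEmbed n g hw).isometry hd,
    Measure.map_smul, Measure.map_smul,
    Measure.map_map hm (frameEmbed n g hw).continuous.measurable]
  simp only [Function.comp_def, norm_sq_frameEmbed_apply]

theorem map_normalizedVolume_union {d : ℝ} (hd : 0 ≤ d) {S : Set (FrameSpace 𝕜 n)}
    (hS : IsCompact S)
    (g : 𝕜 →ₗᵢ[ℝ] ℂ) {w w' : ℍ[ℝ]} (hw : ‖w‖ = 1) (hw' : ‖w'‖ = 1)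
    (hdisj : Disjoint (frameEmbed n g hw '' S) (frameEmbed n g hw' '' S)) :
    (normalizedVolume d (frameEmbed n g hw '' S ∪ frameEmbed n g hw' '' S)).map
        (fun q i => ‖q i‖ ^ 2) =
      (normalizedOn d S).map (fun x i => rowNormSq i x) := by
  have hm : Measurable fun (q : QSpace n) (i : Fin n) => ‖q i‖ ^ 2 :=
    measurable_pi_lambda _ fun i => by fun_prop
  have hmeas : MeasurableSet (frameEmbed n g hw' '' S) :=
    (hS.image (frameEmbed n g hw').continuous).measurableSet
  rw [normalizedVolume, normalizedOn, measure_union hdisj hmeas,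
    (frameEmbed n g hw).isometry.hausdorffMeasure_image (Or.inl hd),
    (frameEmbed n g hw').isometry.hausdorffMeasure_image (Or.inl hd),
    Measure.restrict_union hdisj hmeas,
    restrict_hausdorffMeasure_image (frameEmbed n g hw).isometry hd,
    restrict_hausdorffMeasure_image (frameEmbed n g hw').isometry hd,
    Measure.map_smul, Measure.map_smul, Measure.map_add _ _ hm,
    Measure.map_map hm (frameEmbed n g hw).continuous.measurable,
    Measure.map_map hm (frameEmbed n g hw').continuous.measurable]
  simp only [Function.comp_def, norm_sq_frameEmbed_apply]
  -- Both copies give the same image measure, so the factor `2` cancels against the doubled total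
  -- volume.
  rw [← two_mul, ← two_smul ENNReal, smul_smul, ENNReal.mul_inv (by simp) (by simp), mul_assoc,
    mul_comm _ (2 : ENNReal), ← mul_assoc, ENNReal.inv_mul_cancel (by simp) (by simp), one_mul]

section PolygonMeasure

variable {d : ℝ} {M : Set (QSpace n)} {A : Set (EdgeList n)} {Q : Measure (FrameSpace 𝕜 n)}
  (h : (polygonMeasure d M A).map (fun e i => edgeLength i e) = Q.map (fun x i => rowNormSq i x))
include h

theorem isProbabilityMeasure_of_map_edgeLength [IsProbabilityMeasure Q] :
    IsProbabilityMeasure (polygonMeasure d M A) := by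
  have h1 : Measurable fun (e : A) (i : Fin n) => edgeLength i e :=
    measurable_pi_lambda _ fun i => measurable_edgeLength i
  have h2 : Measurable fun (x : FrameSpace 𝕜 n) (i : Fin n) => rowNormSq i x :=
    measurable_pi_lambda _ fun i => (continuous_rowNormSq i).measurable
  have h3 := congrArg (fun μ => μ univ) h
  simp only [Measure.map_apply h1 .univ, Measure.map_apply h2 .univ, preimage_univ,
    measure_univ] at h3
  exact ⟨h3⟩

/-- A covariance depends only on the joint law, so both sides are covariances of coordinate
functions on `ℝⁿ`. -/
theorem covariance_edgeLength (i j : Fin n) :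
    covariance (edgeLength i) (edgeLength j) (polygonMeasure d M A) =
      covariance (rowNormSq i) (rowNormSq j) Q := by
  have h1 : Measurable fun (e : A) (i : Fin n) => edgeLength i e :=
    measurable_pi_lambda _ fun i => measurable_edgeLength i
  have h2 : Measurable fun (x : FrameSpace 𝕜 n) (i : Fin n) => rowNormSq i x :=
    measurable_pi_lambda _ fun i => (continuous_rowNormSq i).measurable
  have hm : ∀ (k : Fin n) (μ : Measure (Fin n → ℝ)), AEStronglyMeasurable (fun f => f k) μ :=
    fun k μ => (measurable_pi_apply k).aestronglyMeasurable
  have e1 := covariance_map_fun (hm i ((polygonMeasure d M A).map _)) (hm j _) h1.aemeasurable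
  have e2 := covariance_map_fun (hm i (Q.map _)) (hm j _) h2.aemeasurable
  rw [h, e2] at e1
  exact e1.symm

theorem variance_edgeLength (i : Fin n) :
    variance (edgeLength i) (polygonMeasure d M A) =
      covariance (rowNormSq i) (rowNormSq i) Q := by
  rw [← covariance_edgeLength h, covariance_self]
  exact (measurable_edgeLength i).aemeasurable

end PolygonMeasure

end Transfer

/-! ### The model spaces and their images under the Hopf map -/

section ModelSpaces

variable {n : ℕ}

theorem norm_quatI : ‖quatI‖ = 1 := by
  have h := Quaternion.normSq_eq_norm_mul_self quatI
  rw [Quaternion.normSq_def'] at h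
  rw [← pow_eq_one_iff_of_nonneg (norm_nonneg _) two_ne_zero, pow_two, ← h]
  simp [quatI]

theorem quatI_mul_quatOfComplex (a b : ℂ) :
    quatI * quatOfComplex a b = quatOfComplex (Complex.I * a) (Complex.I * b) := by
  have h : quatI.re = 0 ∧ quatI.imI = 1 ∧ quatI.imJ = 0 ∧ quatI.imK = 0 := ⟨rfl, rfl, rfl, rfl⟩
  ext <;> simp [h] <;> simp [quatOfComplex]

/-- `(u, v) ↦ u + v𝐣` on `ℂⁿ ⊕ ℂⁿ`. -/
noncomputable abbrev embedComplex (n : ℕ) : FrameSpace ℂ n →ₗᵢ[ℝ] QSpace n :=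
  frameEmbed n LinearIsometry.id norm_one

/-- `(u, v) ↦ u + v𝐣` on `ℝⁿ ⊕ ℝⁿ`. -/
noncomputable abbrev embedReal (n : ℕ) : FrameSpace ℝ n →ₗᵢ[ℝ] QSpace n :=
  frameEmbed n Complex.ofRealLI norm_one

/-- `(u, v) ↦ 𝐢(u + v𝐣)` on `ℝⁿ ⊕ ℝⁿ`. -/
noncomputable abbrev embedRealI (n : ℕ) : FrameSpace ℝ n →ₗᵢ[ℝ] QSpace n :=
  frameEmbed n Complex.ofRealLI norm_quatI

theorem embedComplex_apply (x : FrameSpace ℂ n) (l : Fin n) :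
    embedComplex n x l = quatOfComplex (x 0 l) (x 1 l) := one_mul _

theorem embedReal_apply (x : FrameSpace ℝ n) (l : Fin n) :
    embedReal n x l = quatOfComplex (x 0 l) (x 1 l) := one_mul _

theorem embedRealI_apply (x : FrameSpace ℝ n) (l : Fin n) :
    embedRealI n x l = quatI * quatOfComplex (x 0 l) (x 1 l) := rfl

theorem image_frames {𝕜 : Type*} [RCLike 𝕜] (f : FrameSpace 𝕜 n → QSpace n)
    (c : 𝕜 → 𝕜 → ℍ[ℝ]) (hf : ∀ x l, f x l = c (x 0 l) (x 1 l)) :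
    f '' frames 𝕜 n = {q | ∃ u v : EuclideanSpace 𝕜 (Fin n),
      Orthonormal 𝕜 ![u, v] ∧ ∀ l, q l = c (u l) (v l)} := by
  ext q
  constructor
  · rintro ⟨x, hx, rfl⟩
    exact ⟨x 0, x 1, hx, hf x⟩
  · rintro ⟨u, v, huv, hq⟩
    refine ⟨WithLp.toLp 2 ![u, v], huv, ?_⟩
    ext l : 1
    rw [hf, hq]
    rfl

theorem stiefelC_eq : stiefelC n = embedComplex n '' frames ℂ n :=
  (image_frames _ quatOfComplex embedComplex_apply).symm

theorem stiefelR_eq : stiefelR n = embedReal n '' frames ℝ n ∪ embedRealI n '' frames ℝ n := by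
  rw [image_frames _ (fun a b : ℝ => quatOfComplex a b) embedReal_apply,
    image_frames _ (fun a b : ℝ => quatI * quatOfComplex a b) embedRealI_apply]
  rfl

theorem mem_sphereH_frameEmbed {𝕜 : Type*} [RCLike 𝕜] (f : FrameSpace 𝕜 n →ₗᵢ[ℝ] QSpace n)
    {x : FrameSpace 𝕜 n} : f x ∈ sphereH n ↔ x ∈ pairSphere 𝕜 n := by
  simp [sphereH, pairSphere]

theorem sphereH_eq : sphereH n = embedComplex n '' pairSphere ℂ n := by
  ext q
  constructor
  · intro hq
    obtain ⟨x, rfl⟩ : ∃ x, embedComplex n x = q := by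
      refine ⟨WithLp.toLp 2 ![WithLp.toLp 2 fun l => ⟨(q l).re, (q l).imI⟩,
        WithLp.toLp 2 fun l => ⟨(q l).imJ, (q l).imK⟩], ?_⟩
      ext l : 1
      rw [embedComplex_apply]
      rfl
    exact ⟨x, (mem_sphereH_frameEmbed _).1 hq, rfl⟩
  · rintro ⟨x, hx, rfl⟩
    exact (mem_sphereH_frameEmbed _).2 hx

theorem sphereC_eq :
    sphereC n = embedReal n '' pairSphere ℝ n ∪ embedRealI n '' pairSphere ℝ n := by
  unfold sphereC
  congr 1 <;> ext q <;> constructor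
  · rintro ⟨hq, h⟩
    obtain ⟨x, rfl⟩ : ∃ x, embedReal n x = q := by
      refine ⟨WithLp.toLp 2 ![WithLp.toLp 2 fun l => (q l).re,
        WithLp.toLp 2 fun l => (q l).imJ], ?_⟩
      ext l : 1
      rw [embedReal_apply]
      ext <;> simp [quatOfComplex, h]
    exact ⟨x, (mem_sphereH_frameEmbed _).1 hq, rfl⟩
  · rintro ⟨x, hx, rfl⟩
    refine ⟨(mem_sphereH_frameEmbed _).2 hx, fun l => ?_⟩
    rw [embedReal_apply]
    simp [quatOfComplex]
  · rintro ⟨hq, h⟩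
    obtain ⟨x, rfl⟩ : ∃ x, embedRealI n x = q := by
      refine ⟨WithLp.toLp 2 ![WithLp.toLp 2 fun l => (q l).imI,
        WithLp.toLp 2 fun l => (q l).imK], ?_⟩
      ext l : 1
      rw [embedRealI_apply, quatI_mul_quatOfComplex]
      ext <;> simp [quatOfComplex, h]
    exact ⟨x, (mem_sphereH_frameEmbed _).1 hq, rfl⟩
  · rintro ⟨x, hx, rfl⟩
    refine ⟨(mem_sphereH_frameEmbed _).2 hx, fun l => ?_⟩
    rw [embedRealI_apply, quatI_mul_quatOfComplex]
    simp [quatOfComplex]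

/-- The two images lie in `(1 ⊕ 𝐣)ⁿ` and `(𝐢 ⊕ 𝐤)ⁿ`, which meet only in `0`, and `0` is not on the
sphere. -/
theorem disjoint_embedReal_embedRealI {S : Set (FrameSpace ℝ n)} (hS : S ⊆ pairSphere ℝ n) :
    Disjoint (embedReal n '' S) (embedRealI n '' S) := by
  rw [Set.disjoint_left]
  rintro _ ⟨x, hx, rfl⟩ ⟨y, hy, hxy⟩
  have h0 : embedReal n x = 0 := by
    ext l : 1
    have h := congrArg (fun q : QSpace n => q l) hxy
    simp only [embedReal_apply, embedRealI_apply, quatI_mul_quatOfComplex] at h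
    have hre : 0 = x 0 l := by simpa [quatOfComplex] using congrArg QuaternionAlgebra.re h
    have himJ : 0 = x 1 l := by simpa [quatOfComplex] using congrArg QuaternionAlgebra.imJ h
    rw [embedReal_apply, ← hre, ← himJ]
    rfl
  rw [map_eq_zero_iff _ (embedReal n).injective] at h0
  have h := mem_pairSphere_iff.1 (hS hx)
  simp [h0] at h

theorem mapsTo_sphereH : MapsTo (hopfMap n) (sphereH n) (Arm₃ n) := by
  intro q hq
  have h : ‖q‖ = Real.sqrt 2 := by simpa [sphereH] using hq
  change ∑ i, ‖hopf (q i)‖ = 2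
  simp only [norm_hopf]
  rw [← PiLp.norm_sq_eq_of_L2, h, Real.sq_sqrt (by norm_num)]

theorem stiefelC_subset : stiefelC n ⊆ sphereH n := by
  rw [stiefelC_eq, sphereH_eq]
  exact image_mono frames_subset_pairSphere

/-- The three components of the sum of the edges are `‖u‖² - ‖v‖²` and, up to the factors `-2` and
`2`, the imaginary and real parts of the Hermitian product of `u` and `v`. Closing up is exactly
what orthonormality provides. -/
theorem sum_hopf_embedComplex {x : FrameSpace ℂ n} (hx : x ∈ frames ℂ n) :
    ∑ l, hopfMap n (embedComplex n x) l = 0 := by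
  obtain ⟨h0, h1, h2⟩ := mem_frames_iff.1 hx
  have h0 : ∑ l, ‖x 0 l‖ ^ 2 = 1 := by rw [← EuclideanSpace.norm_sq_eq, h0, one_pow]
  have h1 : ∑ l, ‖x 1 l‖ ^ 2 = 1 := by rw [← EuclideanSpace.norm_sq_eq, h1, one_pow]
  rw [PiLp.inner_apply] at h2
  have hre := congrArg Complex.re h2
  have him := congrArg Complex.im h2
  rw [Complex.re_sum] at hre
  rw [Complex.im_sum] at him
  simp only [hopfMap, embedComplex_apply]
  ext k
  rw [WithLp.ofLp_sum, Finset.sum_apply]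
  fin_cases k
  · have h : ∑ l, (‖x 0 l‖ ^ 2 - ‖x 1 l‖ ^ 2) = 0 := by
      rw [Finset.sum_sub_distrib, h0, h1, sub_self]
    refine (Finset.sum_congr rfl fun l _ => ?_).trans h
    rw [← Complex.normSq_eq_norm_sq, ← Complex.normSq_eq_norm_sq, Complex.normSq_apply,
      Complex.normSq_apply]
    refine (hopf_apply_zero _).trans ?_
    simp only [quatOfComplex]
    ring
  · have h : ∑ l, (-2) * (inner ℂ (x 0 l) (x 1 l)).im = 0 := by
      rw [← Finset.mul_sum, him]; simp
    refine (Finset.sum_congr rfl fun l _ => ?_).trans h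
    refine (hopf_apply_one _).trans ?_
    simp [quatOfComplex]
    ring
  · have h : ∑ l, 2 * (inner ℂ (x 0 l) (x 1 l)).re = 0 := by
      rw [← Finset.mul_sum, hre]; simp
    refine (Finset.sum_congr rfl fun l _ => ?_).trans h
    refine (hopf_apply_two _).trans ?_
    simp [quatOfComplex]
    ring

theorem mapsTo_stiefelC : MapsTo (hopfMap n) (stiefelC n) (Pol₃ n) := by
  intro q hq
  refine ⟨mapsTo_sphereH (stiefelC_subset hq), ?_⟩
  rw [stiefelC_eq] at hq
  obtain ⟨x, hx, rfl⟩ := hq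
  exact sum_hopf_embedComplex hx

theorem mapsTo_sphereC : MapsTo (hopfMap n) (sphereC n) (Arm₂ n) := by
  rintro q (⟨hq, h⟩ | ⟨hq, h⟩) <;> refine ⟨mapsTo_sphereH hq, fun l => ?_⟩ <;>
    simp [hopfMap, hopf_apply_one, h]

theorem stiefelR_subset : stiefelR n ⊆ sphereC n := by
  rw [stiefelR_eq, sphereC_eq]
  exact union_subset_union (image_mono frames_subset_pairSphere)
    (image_mono frames_subset_pairSphere)

theorem mapsTo_stiefelR : MapsTo (hopfMap n) (stiefelR n) (Pol₂ n) := by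
  intro q hq
  refine ⟨mapsTo_sphereC (stiefelR_subset hq), ?_⟩
  rw [stiefelR_eq] at hq
  -- A real frame times a unit complex number `z` is a Hermitian frame, so closedness follows from
  -- the complex case with `z = 1` and `z = 𝐢`.
  have key : ∀ (f : FrameSpace ℝ n → QSpace n) (z : ℂ), ‖z‖ = 1 →
      (∀ x l, f x l = quatOfComplex (z * x 0 l) (z * x 1 l)) → ∀ x ∈ frames ℝ n,
      ∑ l, hopfMap n (f x) l = 0 := by
    intro f z hz hf x hx
    let y : FrameSpace ℂ n := WithLp.toLp 2 ![WithLp.toLp 2 fun l => z * x 0 l,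
      WithLp.toLp 2 fun l => z * x 1 l]
    have hy : f x = embedComplex n y := by
      ext l : 1
      rw [hf, embedComplex_apply]
      rfl
    rw [hy]
    apply sum_hopf_embedComplex
    obtain ⟨h0, h1, h2⟩ := mem_frames_iff.1 hx
    have hn : ∀ w : EuclideanSpace ℝ (Fin n), ‖w‖ = 1 →
        ‖(WithLp.toLp 2 fun l => z * w l : EuclideanSpace ℂ (Fin n))‖ = 1 := by
      intro w hw
      rw [EuclideanSpace.norm_eq] at hw ⊢
      simpa [hz] using hw
    refine mem_frames_iff.2 ⟨hn _ h0, hn _ h1, ?_⟩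
    rw [PiLp.inner_apply] at h2 ⊢
    have hzz : z * (starRingEnd ℂ) z = 1 := by rw [Complex.mul_conj, Complex.normSq_eq_norm_sq, hz]; simp
    have h3 : ∀ l, inner ℂ (y 0 l) (y 1 l) = ((inner ℝ (x 0 l) (x 1 l) : ℝ) : ℂ) := by
      intro l
      change inner ℂ (z * (x 0 l : ℂ)) (z * (x 1 l : ℂ)) = _
      simp only [RCLike.inner_apply, map_mul, Complex.conj_ofReal, Complex.ofReal_mul, conj_trivial]
      linear_combination (x 0 l * x 1 l : ℂ) * hzz
    rw [Finset.sum_congr rfl fun l _ => h3 l, ← Complex.ofReal_sum, h2, Complex.ofReal_zero]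
  rcases hq with ⟨x, hx, rfl⟩ | ⟨x, hx, rfl⟩
  · exact key _ 1 norm_one (fun x l => by rw [embedReal_apply, one_mul, one_mul]) x hx
  · exact key _ Complex.I Complex.norm_I
      (fun x l => by rw [embedRealI_apply, quatI_mul_quatOfComplex]) x hx

end ModelSpaces

/-! ### The four symmetric measures -/

section SymmetricMeasures

variable {n : ℕ}

theorem map_edgeLength_symmArm₃ (hn : 1 ≤ n) :
    (symmArm₃ n).map (fun e i => edgeLength i e) =
      (normalizedOn (4 * n - 1) (pairSphere ℂ n)).map (fun x i => rowNormSq i x) := by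
  have hn' : (1 : ℝ) ≤ n := by exact_mod_cast hn
  have hM : MeasurableSet (sphereH n) := Metric.isClosed_sphere.measurableSet
  rw [symmArm₃, map_edgeLength_polygonMeasure hM
    isClosed_arm₃.measurableSet mapsTo_sphereH, sphereH_eq,
    map_normalizedVolume_image (by linarith)]

theorem map_edgeLength_symmPol₃ (hn : 2 ≤ n) :
    (symmPol₃ n).map (fun e i => edgeLength i e) =
      (normalizedOn (4 * n - 4) (frames ℂ n)).map (fun x i => rowNormSq i x) := by
  have hn' : (2 : ℝ) ≤ n := by exact_mod_cast hn
  have hM : MeasurableSet (stiefelC n) := by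
    rw [stiefelC_eq]
    exact (isCompact_frames.image (embedComplex n).continuous).measurableSet
  rw [symmPol₃, map_edgeLength_polygonMeasure hM isClosed_pol₃.measurableSet mapsTo_stiefelC,
    stiefelC_eq, map_normalizedVolume_image (by linarith)]

theorem map_edgeLength_symmArm₂ (hn : 1 ≤ n) :
    (symmArm₂ n).map (fun e i => edgeLength i e) =
      (normalizedOn (2 * n - 1) (pairSphere ℝ n)).map (fun x i => rowNormSq i x) := by
  have hn' : (1 : ℝ) ≤ n := by exact_mod_cast hn
  have hM : MeasurableSet (sphereC n) := by
    rw [sphereC_eq]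
    exact (isCompact_pairSphere.image (embedReal n).continuous).measurableSet.union
      (isCompact_pairSphere.image (embedRealI n).continuous).measurableSet
  rw [symmArm₂, map_edgeLength_polygonMeasure hM isClosed_arm₂.measurableSet mapsTo_sphereC,
    sphereC_eq, map_normalizedVolume_union (by linarith) isCompact_pairSphere _ _ _
      (disjoint_embedReal_embedRealI subset_rfl)]

theorem map_edgeLength_symmPol₂ (hn : 2 ≤ n) :
    (symmPol₂ n).map (fun e i => edgeLength i e) =
      (normalizedOn (2 * n - 3) (frames ℝ n)).map (fun x i => rowNormSq i x) := by
  have hn' : (2 : ℝ) ≤ n := by exact_mod_cast hn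
  have hM : MeasurableSet (stiefelR n) := by
    rw [stiefelR_eq]
    exact (isCompact_frames.image (embedReal n).continuous).measurableSet.union
      (isCompact_frames.image (embedRealI n).continuous).measurableSet
  rw [symmPol₂, map_edgeLength_polygonMeasure hM isClosed_pol₂.measurableSet mapsTo_stiefelR,
    stiefelR_eq, map_normalizedVolume_union (by linarith) isCompact_frames _ _ _
      (disjoint_embedReal_embedRealI frames_subset_pairSphere)]

/-- The phase `ω = I` exchanges real and imaginary parts up to sign, whence `τ = 1` over `ℂ`. -/
theorem re_sq_add_re_I_mul_sq (z : ℂ) :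
    RCLike.re z ^ 2 + RCLike.re (Complex.I * z) ^ 2 = 1 * ‖z‖ ^ 2 := by
  rw [← Complex.normSq_eq_norm_sq, Complex.normSq_apply]
  simp
  ring

/-- Real scalars have no imaginary part to average over. The trivial phase `ω = 1` already works,
with `τ = 2`. -/
theorem re_sq_add_re_one_mul_sq (z : ℝ) :
    RCLike.re z ^ 2 + RCLike.re (1 * z) ^ 2 = 2 * ‖z‖ ^ 2 := by
  simp
  ring

theorem symmArm₃_moments (hn : 1 ≤ n) : IsProbabilityMeasure (symmArm₃ n) ∧
    (∀ i, variance (edgeLength i) (symmArm₃ n) =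
      2 * ((n : ℝ) - 1) / ((n : ℝ) ^ 2 * ((n : ℝ) + 1 / 2))) ∧
    ∀ i j, i ≠ j → covariance (edgeLength i) (edgeLength j) (symmArm₃ n) =
      -2 / ((n : ℝ) ^ 2 * ((n : ℝ) + 1 / 2)) := by
  obtain ⟨h0, h1⟩ := hausdorffMeasure_pairSphere (𝕜 := ℂ) hn (d := 4 * n - 1)
    (by rw [Complex.finrank_real_complex]; push_cast; ring)
  have := isProbabilityMeasure_normalizedOn h0 h1
  have hmap := map_edgeLength_symmArm₃ hn
  obtain ⟨hv, hc⟩ := (frameInvariant_pairSphere h0 h1).covariance_rowNormSq Complex.norm_I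
    zero_le_one re_sq_add_re_I_mul_sq (ae_mem_normalizedOn isCompact_pairSphere.measurableSet)
    (integral_pow_four_pairSphere h0 h1 Complex.norm_I zero_le_one re_sq_add_re_I_mul_sq)
  have hn' : (0 : ℝ) < n := by positivity
  refine ⟨isProbabilityMeasure_of_map_edgeLength hmap, fun i => ?_, fun i j hij => ?_⟩
  · rw [symmArm₃, variance_edgeLength hmap, hv]
    field_simp
    ring
  · have hn1 : (n : ℝ) - 1 ≠ 0 := natCast_sub_one_ne_zero hij
    rw [symmArm₃, covariance_edgeLength hmap, hc i j hij]
    field_simp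
    ring

theorem symmArm₂_moments (hn : 1 ≤ n) : IsProbabilityMeasure (symmArm₂ n) ∧
    (∀ i, variance (edgeLength i) (symmArm₂ n) =
      4 * ((n : ℝ) - 1) / ((n : ℝ) ^ 2 * ((n : ℝ) + 1))) ∧
    ∀ i j, i ≠ j → covariance (edgeLength i) (edgeLength j) (symmArm₂ n) =
      -4 / ((n : ℝ) ^ 2 * ((n : ℝ) + 1)) := by
  obtain ⟨h0, h1⟩ := hausdorffMeasure_pairSphere (𝕜 := ℝ) hn (d := 2 * n - 1)
    (by rw [finrank_self]; push_cast; ring)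
  have := isProbabilityMeasure_normalizedOn h0 h1
  have hmap := map_edgeLength_symmArm₂ hn
  obtain ⟨hv, hc⟩ := (frameInvariant_pairSphere h0 h1).covariance_rowNormSq norm_one
    zero_le_two re_sq_add_re_one_mul_sq (ae_mem_normalizedOn isCompact_pairSphere.measurableSet)
    (integral_pow_four_pairSphere h0 h1 norm_one zero_le_two re_sq_add_re_one_mul_sq)
  have hn' : (0 : ℝ) < n := by positivity
  refine ⟨isProbabilityMeasure_of_map_edgeLength hmap, fun i => ?_, fun i j hij => ?_⟩
  · rw [symmArm₂, variance_edgeLength hmap, hv]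
    field_simp
    ring
  · have hn1 : (n : ℝ) - 1 ≠ 0 := natCast_sub_one_ne_zero hij
    rw [symmArm₂, covariance_edgeLength hmap, hc i j hij]
    field_simp
    ring

theorem symmPol₃_moments (hn : 2 ≤ n) : IsProbabilityMeasure (symmPol₃ n) ∧
    (∀ i, variance (edgeLength i) (symmPol₃ n) =
      2 * ((n : ℝ) - 2) / ((n : ℝ) ^ 2 * ((n : ℝ) + 1))) ∧
    ∀ i j, i ≠ j → covariance (edgeLength i) (edgeLength j) (symmPol₃ n) =
      ((n : ℝ) - 2) / ((n : ℝ) - 1) * (-2 / ((n : ℝ) ^ 2 * ((n : ℝ) + 1))) := by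
  obtain ⟨h0, h1⟩ := hausdorffMeasure_frames (𝕜 := ℂ) hn (d := 4 * n - 4)
    (by rw [Complex.finrank_real_complex]; push_cast; ring)
  have := isProbabilityMeasure_normalizedOn h0 h1
  have hmap := map_edgeLength_symmPol₃ hn
  obtain ⟨hv, hc⟩ := (frameInvariant_frames h0 h1).covariance_rowNormSq Complex.norm_I
    zero_le_one re_sq_add_re_I_mul_sq
    ((ae_mem_normalizedOn isClosed_frames.measurableSet).mono fun _ hx =>
      frames_subset_pairSphere hx)
    (integral_pow_four_frames h0 h1 Complex.norm_I zero_le_one re_sq_add_re_I_mul_sq)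
  have hn' : (0 : ℝ) < n := by positivity
  refine ⟨isProbabilityMeasure_of_map_edgeLength hmap, fun i => ?_, fun i j hij => ?_⟩
  · rw [symmPol₃, variance_edgeLength hmap, hv]
    field_simp
    ring
  · have hn1 : (n : ℝ) - 1 ≠ 0 := natCast_sub_one_ne_zero hij
    rw [symmPol₃, covariance_edgeLength hmap, hc i j hij]
    field_simp
    ring

theorem symmPol₂_moments (hn : 2 ≤ n) : IsProbabilityMeasure (symmPol₂ n) ∧
    (∀ i, variance (edgeLength i) (symmPol₂ n) =
      4 * ((n : ℝ) - 2) / ((n : ℝ) ^ 2 * ((n : ℝ) + 2))) ∧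
    ∀ i j, i ≠ j → covariance (edgeLength i) (edgeLength j) (symmPol₂ n) =
      ((n : ℝ) - 2) / ((n : ℝ) - 1) * (-4 / ((n : ℝ) ^ 2 * ((n : ℝ) + 2))) := by
  obtain ⟨h0, h1⟩ := hausdorffMeasure_frames (𝕜 := ℝ) hn (d := 2 * n - 3)
    (by rw [finrank_self]; push_cast; ring)
  have := isProbabilityMeasure_normalizedOn h0 h1
  have hmap := map_edgeLength_symmPol₂ hn
  obtain ⟨hv, hc⟩ := (frameInvariant_frames h0 h1).covariance_rowNormSq norm_one
    zero_le_two re_sq_add_re_one_mul_sq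
    ((ae_mem_normalizedOn isClosed_frames.measurableSet).mono fun _ hx =>
      frames_subset_pairSphere hx)
    (integral_pow_four_frames h0 h1 norm_one zero_le_two re_sq_add_re_one_mul_sq)
  have hn' : (0 : ℝ) < n := by positivity
  refine ⟨isProbabilityMeasure_of_map_edgeLength hmap, fun i => ?_, fun i j hij => ?_⟩
  · rw [symmPol₂, variance_edgeLength hmap, hv]
    field_simp
    ring
  · have hn1 : (n : ℝ) - 1 ≠ 0 := natCast_sub_one_ne_zero hij
    rw [symmPol₂, covariance_edgeLength hmap, hc i j hij]
    field_simp
    ring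

end SymmetricMeasures

end RandomPolygon

open RandomPolygon in
theorem corollary5p5 (n : ℕ) :
    -- the symmetric measures are probability measures on the polygon spaces
    (1 ≤ n → IsProbabilityMeasure (symmArm₃ n) ∧ IsProbabilityMeasure (symmArm₂ n)) ∧
    (2 ≤ n → IsProbabilityMeasure (symmPol₃ n) ∧ IsProbabilityMeasure (symmPol₂ n)) ∧
    -- variances
    (∀ i : Fin n,
      variance (edgeLength i) (symmArm₃ n) = 2 * ((n : ℝ) - 1) / ((n : ℝ) ^ 2 * ((n : ℝ) + 1 / 2)) ∧
      variance (edgeLength i) (symmArm₂ n) = 4 * ((n : ℝ) - 1) / ((n : ℝ) ^ 2 * ((n : ℝ) + 1))) ∧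
    (2 ≤ n → ∀ i : Fin n,
      variance (edgeLength i) (symmPol₃ n) = 2 * ((n : ℝ) - 2) / ((n : ℝ) ^ 2 * ((n : ℝ) + 1)) ∧
      variance (edgeLength i) (symmPol₂ n) = 4 * ((n : ℝ) - 2) / ((n : ℝ) ^ 2 * ((n : ℝ) + 2))) ∧
    -- covariances (two distinct indices force `2 ≤ n`)
    (∀ i j : Fin n, i ≠ j →
      covariance (edgeLength i) (edgeLength j) (symmArm₃ n) =
        -2 / ((n : ℝ) ^ 2 * ((n : ℝ) + 1 / 2)) ∧
      covariance (edgeLength i) (edgeLength j) (symmPol₃ n) =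
        ((n : ℝ) - 2) / ((n : ℝ) - 1) * (-2 / ((n : ℝ) ^ 2 * ((n : ℝ) + 1))) ∧
      covariance (edgeLength i) (edgeLength j) (symmArm₂ n) =
        -4 / ((n : ℝ) ^ 2 * ((n : ℝ) + 1)) ∧
      covariance (edgeLength i) (edgeLength j) (symmPol₂ n) =
        ((n : ℝ) - 2) / ((n : ℝ) - 1) * (-4 / ((n : ℝ) ^ 2 * ((n : ℝ) + 2)))) := by
  refine ⟨fun hn => ⟨symmArm₃_moments hn |>.1, symmArm₂_moments hn |>.1⟩,
    fun hn => ⟨symmPol₃_moments hn |>.1, symmPol₂_moments hn |>.1⟩,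
    fun i => ⟨(symmArm₃_moments (Fin.pos i)).2.1 i, (symmArm₂_moments (Fin.pos i)).2.1 i⟩,
    fun hn i => ⟨(symmPol₃_moments hn).2.1 i, (symmPol₂_moments hn).2.1 i⟩, fun i j hij => ?_⟩
  have h1 : 1 ≤ n := Fin.pos i
  have h2 : 2 ≤ n := by
    by_contra h
    have : Subsingleton (Fin n) := Fin.subsingleton_iff_le_one.2 (by omega)
    exact hij (Subsingleton.elim _ _)
  exact ⟨(symmArm₃_moments h1).2.2 i j hij, (symmPol₃_moments h2).2.2 i j hij,
    (symmArm₂_moments h1).2.2 i j hij, (symmPol₂_moments h2).2.2 i j hij⟩
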